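/- \textbf{Theorem (Stability).} For $E=\mathbb{R}^d$ or $E=\mathbb{R}^d\times\mathbb{R}^d$, let $\mathrm{M}_0(E)$ be the set of nonnegative Borel measures on $E\setminus\{0\}$ that are finite on every Borel set $B\subset E\setminus\{0\}$ with $0\notin\operatorname{cl}(B)$. Equip $\mathrm{M}_0(E)$ with the weakest topology that makes $\mu\mapsto\int f\,\mathrm{d}\mu$ continuous for every bounded continuous $f:E\setminus\{0\}\to\mathbb{R}$ vanishing on a neighbourhood of the origin. The support $\operatorname{supp}\mu\subset E$ of $\mu\in\mathrm{M}_0(E)$ is the support of its extension to $E$ that gives mass zero to $\{0\}$; it may contain $0$. For $\mu,\nu\in\mathrm{M}_0(\mathbb{R}^d)$, let $\Gamma_0(\mu,\nu)$ be the set of zero-couplings of $\mu$ and $\nu$: the Borel measures $\gamma$ on $(\mathbb{R}^d\times\mathbb{R}^d)\setminus\{0\}$ such that $\gamma(A\times\mathbb{R}^d)=\mu(A)$ and $\gamma(\mathbb{R}^d\times A)=\nu(A)$ for all Borel sets $A\subset\mathbb{R}^d\setminus\{0\}$; such $\gamma$ belong to $\mathrm{M}_0(\mathbb{R}^d\times\mathbb{R}^d)$.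 A set $T\subset\mathbb{R}^d\times\mathbb{R}^d$ is cyclically monotone if $\sum_{i=1}^m\langle x_i,y_i\rangle\ge\sum_{i=1}^m\langle x_i,y_{i+1}\rangle$ for all $m\ge2$ and all $(x_1,y_1),\dots,(x_m,y_m)\in T$, with $y_{m+1}:=y_1$; it is maximal cyclically monotone if moreover it is not strictly included in another cyclically monotone set. Let $\Gamma_{0,\mathrm{cm}}(\mu,\nu)$ be the set of those $\gamma\in\Gamma_0(\mu,\nu)$ for which $\operatorname{supp}\gamma$ is cyclically monotone. Let $\mathcal{F}$ be the space of all closed subsets of $\mathbb{R}^d\times\mathbb{R}^d$ (including the empty set) with the Fell topology, generated by the families $\{F: F\cap G\neq\emptyset\}$, $G$ open, and $\{F: F\cap K=\emptyset\}$, $K$ compact. Let $\mu_n\to\mu$ and $\nu_n\to\nu$ in $\mathrm{M}_0(\mathbb{R}^d)$, let $\gamma_n\in\Gamma_0(\mu_n,\nu_n)$, and let $T_n\in\mathcal{F}$ satisfy $\operatorname{supp}\gamma_n\subset T_n$, for $n\in\mathbb{N}$. Then there exist an infinite set $N\subset\mathbb{N}$, some $\gamma\in\Gamma_0(\mu,\nu)$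 and some $T\in\mathcal{F}$ such that, as $n\to\infty$ in $N$, (a) $\gamma_n\to\gamma$ in $\mathrm{M}_0(\mathbb{R}^d\times\mathbb{R}^d)$, (b) $T_n\to T$ in the Fell topology, (c) $\operatorname{supp}\gamma\subset T$. Suppose in addition that $\gamma_n\in\Gamma_{0,\mathrm{cm}}(\mu_n,\nu_n)$ and that $T_n$ is maximal cyclically monotone for every $n$. Then every limit point of $(\gamma_n)_n$ in $\mathrm{M}_0(\mathbb{R}^d\times\mathbb{R}^d)$ belongs to $\Gamma_{0,\mathrm{cm}}(\mu,\nu)$ and, provided that $\mu$ and $\nu$ are not both the zero measure, every limit point of $(T_n)_n$ in $\mathcal{F}$ is maximal cyclically monotone. (A limit point of a sequence is a point each of whose neighbourhoods contains infinitely many terms of the sequence, counted with their indices.) -/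

import Mathlib

open Filter Topology MeasureTheory

namespace ZeroCoupling

/-- The punctured space `E ∖ {0}`, with the subspace topology and the trace σ-algebra. -/
abbrev Punctured (E : Type*) [Zero E] : Type _ := {x : E // x ≠ 0}

/-- A measure on `E ∖ {0}` is finite away from the origin if it is finite on every measurable set
`B` bounded away from the origin, i.e. such that `0` is not in the closure of `B` in `E`. -/
def FiniteAwayFromZero {E : Type*} [TopologicalSpace E] [Zero E] [MeasurableSpace E]
    (μ : Measure (Punctured E)) : Prop :=
  ∀ B : Set (Punctured E), MeasurableSet B →
    (0 : E) ∉ closure (Subtype.val '' B) → μ B < ⊤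

/-- The space `M₀(E)` of Borel measures on `E ∖ {0}` that are finite on the sets bounded away
from the origin. -/
structure MZero (E : Type*) [TopologicalSpace E] [Zero E] [MeasurableSpace E] where
  /-- The underlying measure on the punctured space. -/
  toMeasure : Measure (Punctured E)
  /-- It is finite on sets bounded away from the origin. -/
  finite_away : FiniteAwayFromZero toMeasure

/-- The test functions `C₀(E)`: bounded continuous real functions on `E ∖ {0}` that vanish on a
neighbourhood of the origin. -/
def TestFunction (E : Type*) [TopologicalSpace E] [Zero E] : Type _ :=
  {f : BoundedContinuousFunction (Punctured E) ℝ //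
    ∃ U ∈ 𝓝 (0 : E), ∀ x : Punctured E, (x : E) ∈ U → f x = 0}

/-- The topology of `M₀(E)`: the weakest one for which `μ ↦ ∫ f dμ` is continuous for each
test function `f`. -/
noncomputable instance {E : Type*} [TopologicalSpace E] [Zero E] [MeasurableSpace E] :
    TopologicalSpace (MZero E) :=
  ⨅ f : TestFunction E,
    TopologicalSpace.induced (fun μ : MZero E => ∫ x, f.1 x ∂μ.toMeasure) inferInstance

/-- Convergence in `M₀(E)` is convergence of the integrals of all test functions. -/
theorem tendsto_mZero_iff {E : Type*} [TopologicalSpace E] [Zero E] [MeasurableSpace E]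
    {ι : Type*} {l : Filter ι} {u : ι → MZero E} {μ : MZero E} :
    Tendsto u l (𝓝 μ) ↔ ∀ f : TestFunction E,
      Tendsto (fun i => ∫ x, f.1 x ∂(u i).toMeasure) l (𝓝 (∫ x, f.1 x ∂μ.toMeasure)) := by
  simp only [nhds_iInf, nhds_induced, tendsto_iInf, tendsto_comap_iff, Function.comp_def]

/-- The extension of a measure on `E ∖ {0}` to `E` that gives no mass to the origin. -/
noncomputable def nullExtension {E : Type*} [Zero E] [MeasurableSpace E]
    (μ : Measure (Punctured E)) : Measure E :=
  μ.map Subtype.val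

/-- The support of `μ ∈ M₀(E)`, a subset of `E` (it may contain `0`): the support of the extension
of `μ` to `E`, i.e. the points all of whose neighbourhoods have positive mass. -/
noncomputable def MZero.support {E : Type*} [TopologicalSpace E] [Zero E] [MeasurableSpace E]
    (μ : MZero E) : Set E :=
  (nullExtension μ.toMeasure).support

section Marginals

variable {E : Type*} [Zero E] [MeasurableSpace E]

/-- The left zero-marginal of a measure `γ` on `(E × E) ∖ {0}`: the measure on `E ∖ {0}`
given by `A ↦ γ (A × E)`. -/
noncomputable def leftMarginal (γ : Measure (Punctured (E × E))) : Measure (Punctured E) :=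
  (γ.map fun z => z.1.1).comap Subtype.val

/-- The right zero-marginal of a measure `γ` on `(E × E) ∖ {0}`: the measure on `E ∖ {0}`
given by `A ↦ γ (E × A)`. -/
noncomputable def rightMarginal (γ : Measure (Punctured (E × E))) : Measure (Punctured E) :=
  (γ.map fun z => z.1.2).comap Subtype.val

variable [MeasurableSingletonClass E]

theorem leftMarginal_apply (γ : Measure (Punctured (E × E))) {A : Set (Punctured E)}
    (hA : MeasurableSet A) :
    leftMarginal γ A = γ {z | z.1.1 ∈ Subtype.val '' A} := by
  have emb : MeasurableEmbedding (Subtype.val : Punctured E → E) :=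
    MeasurableEmbedding.subtype_coe (measurableSet_singleton 0).compl
  rw [leftMarginal, emb.comap_apply,
    Measure.map_apply (f := fun z : Punctured (E × E) => z.1.1)
      (measurable_fst.comp measurable_subtype_coe)
      (emb.measurableSet_image' hA)]
  rfl

theorem rightMarginal_apply (γ : Measure (Punctured (E × E))) {A : Set (Punctured E)}
    (hA : MeasurableSet A) :
    rightMarginal γ A = γ {z | z.1.2 ∈ Subtype.val '' A} := by
  have emb : MeasurableEmbedding (Subtype.val : Punctured E → E) :=
    MeasurableEmbedding.subtype_coe (measurableSet_singleton 0).compl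
  rw [rightMarginal, emb.comap_apply,
    Measure.map_apply (f := fun z : Punctured (E × E) => z.1.2)
      (measurable_snd.comp measurable_subtype_coe)
      (emb.measurableSet_image' hA)]
  rfl

end Marginals

/-- A measure on `(E × E) ∖ {0}` whose zero-marginals are finite away from the origin is itself
finite away from the origin; so nothing is lost by looking for zero-couplings in `M₀(E × E)`. -/
theorem finiteAwayFromZero_of_marginals {E : Type*} [TopologicalSpace E] [T1Space E] [Zero E]
    [MeasurableSpace E] [OpensMeasurableSpace E] {γ : Measure (Punctured (E × E))}
    (h₁ : FiniteAwayFromZero (leftMarginal γ)) (h₂ : FiniteAwayFromZero (rightMarginal γ)) :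
    FiniteAwayFromZero γ := by
  intro B _ hB
  have hB' : (closure (Subtype.val '' B))ᶜ ∈ 𝓝 ((0 : E), (0 : E)) :=
    isClosed_closure.isOpen_compl.mem_nhds hB
  obtain ⟨U, hU, W, hW, hUW⟩ := mem_nhds_prod_iff.1 hB'
  obtain ⟨V, hVs, hVo, hV0⟩ := mem_nhds_iff.1 (inter_mem hU hW)
  set A : Set (Punctured E) := {x | x.1 ∉ V} with hA
  have hAm : MeasurableSet A := measurable_subtype_coe hVo.measurableSet.compl
  have hA0 : (0 : E) ∉ closure (Subtype.val '' A) := by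
    intro h
    have : closure (Subtype.val '' A) ⊆ Vᶜ := by
      refine closure_minimal ?_ hVo.isClosed_compl
      rintro _ ⟨x, hx, rfl⟩
      exact hx
    exact this h hV0
  have e₁ := h₁ A hAm hA0
  have e₂ := h₂ A hAm hA0
  rw [leftMarginal_apply γ hAm] at e₁
  rw [rightMarginal_apply γ hAm] at e₂
  refine lt_of_le_of_lt (measure_mono ?_)
    (lt_of_le_of_lt (measure_union_le _ _) (ENNReal.add_lt_top.2 ⟨e₁, e₂⟩))
  intro z hz
  by_contra hcon
  have hcon' : z.1.1 ∉ Subtype.val '' A ∧ z.1.2 ∉ Subtype.val '' A :=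
    ⟨fun h => hcon (Or.inl h), fun h => hcon (Or.inr h)⟩
  have key : ∀ x : E, x ∉ Subtype.val '' A → x ∈ V := by
    intro x hx
    by_contra hxV
    exact hx ⟨⟨x, fun h => hxV (h ▸ hV0)⟩, hxV, rfl⟩
  exact hUW (Set.mk_mem_prod (hVs (key _ hcon'.1)).1 (hVs (key _ hcon'.2)).2)
    (subset_closure ⟨z, hz, rfl⟩)

/-- The set `Γ₀(μ, ν)` of zero-couplings: the measures on `(E × E) ∖ {0}` with left and right
zero-marginals `μ` and `ν`. -/
def zeroCouplings {E : Type*} [TopologicalSpace E] [Zero E] [MeasurableSpace E]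
    (μ ν : MZero E) : Set (MZero (E × E)) :=
  {γ | leftMarginal γ.toMeasure = μ.toMeasure ∧ rightMarginal γ.toMeasure = ν.toMeasure}

/-- A set `T ⊆ E × E` is cyclically monotone if
`∑ ⟪xᵢ, yᵢ₊₁⟫ ≤ ∑ ⟪xᵢ, yᵢ⟫` for all finite families `(x₁, y₁), …, (xₘ, yₘ)` in `T` with `m ≥ 2`
(here `m = n + 2`), where the indices are cyclic: `i + 1` is addition in `Fin (n + 2)`. -/
def IsCyclicallyMonotone {E : Type*} [NormedAddCommGroup E] [InnerProductSpace ℝ E]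
    (T : Set (E × E)) : Prop :=
  ∀ (n : ℕ) (p : Fin (n + 2) → E × E), (∀ i, p i ∈ T) →
    ∑ i, inner ℝ (p i).1 (p (i + 1)).2 ≤ ∑ i, inner ℝ (p i).1 (p i).2

/-- A cyclically monotone set not strictly included in another cyclically monotone set. -/
def IsMaximalCyclicallyMonotone {E : Type*} [NormedAddCommGroup E] [InnerProductSpace ℝ E]
    (T : Set (E × E)) : Prop :=
  Maximal IsCyclicallyMonotone T

/-- The set `Γ₀,cm(μ, ν)` of zero-couplings with cyclically monotone support. -/
def cmZeroCouplings {E : Type*} [NormedAddCommGroup E] [InnerProductSpace ℝ E]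
    [MeasurableSpace E] (μ ν : MZero E) : Set (MZero (E × E)) :=
  {γ | γ ∈ zeroCouplings μ ν ∧ IsCyclicallyMonotone γ.support}

/-- The space `F(X)` of all closed subsets of `X`, including the empty set, to be equipped with
the Fell topology. -/
def FellSpace (X : Type*) [TopologicalSpace X] : Type _ := TopologicalSpace.Closeds X

instance {X : Type*} [TopologicalSpace X] : SetLike (FellSpace X) X :=
  inferInstanceAs (SetLike (TopologicalSpace.Closeds X) X)

/-- The Fell topology, with sub-base the families of closed sets that hit a given open set and
those of closed sets that miss a given compact set. -/
instance {X : Type*} [TopologicalSpace X] : TopologicalSpace (FellSpace X) :=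
  TopologicalSpace.generateFrom
    ({𝒰 | ∃ G : Set X, IsOpen G ∧ 𝒰 = {F : FellSpace X | ((F : Set X) ∩ G).Nonempty}} ∪
      {𝒰 | ∃ K : Set X, IsCompact K ∧ 𝒰 = {F : FellSpace X | (F : Set X) ∩ K = ∅}})

/-- Convergence in the Fell topology: every open set that the limit hits is eventually hit, and
every compact set that the limit misses is eventually missed. -/
theorem tendsto_fell_iff {X : Type*} [TopologicalSpace X] {ι : Type*} {l : Filter ι}
    {u : ι → FellSpace X} {F : FellSpace X} :
    Tendsto u l (𝓝 F) ↔
      (∀ G : Set X, IsOpen G → ((F : Set X) ∩ G).Nonempty →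
        ∀ᶠ i in l, ((u i : Set X) ∩ G).Nonempty) ∧
      (∀ K : Set X, IsCompact K → (F : Set X) ∩ K = ∅ → ∀ᶠ i in l, (u i : Set X) ∩ K = ∅) := by
  rw [TopologicalSpace.tendsto_nhds_generateFrom_iff]
  constructor
  · intro h
    exact ⟨fun G hG hF => h _ (Or.inl ⟨G, hG, rfl⟩) hF, fun K hK hF => h _ (Or.inr ⟨K, hK, rfl⟩) hF⟩
  · rintro ⟨h₁, h₂⟩ _ (⟨G, hG, rfl⟩ | ⟨K, hK, rfl⟩) hF
    · exact h₁ G hG hF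
    · exact h₂ K hK hF

end ZeroCoupling

open ZeroCoupling

/-! The first half is compactness. Off the ball of radius `R` in the max norm, a zero-coupling has
no more mass than its two marginals together (`farCutoff_prod_le`). Convergent marginals therefore
make the couplings bounded away from the origin and tight at infinity. A diagonal argument over
countably many test functions makes all test integrals converge along a subsequence, and Riesz
representation turns the limit functional into a measure. Marginals survive the limit because `F ∘
Prod.fst` is a test function whenever `F` is. Closed sets are compact for the Fell topology by
coding each one by the basic open sets it hits. Supports can only shrink in the limit
(`eventually_support_inter_nonempty`), which gives the inclusion in the Fell limit.

For the second half, a violated cyclic inequality is an open condition on finitely many points, so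
cyclic monotonicity passes to lower limits of sets, hence to supports and Fell limits. Maximality is
not visibly closed and is replaced by Minty's condition: every `z` is `p.1 + p.2` for some `p ∈ T`.
Maximal sets satisfy it by Rockafellar's potential and a proximal point; conversely it forces
maximality. It is stable because the solution `p` depends on `z` in a nonexpansive way, which
confines solutions to a compact set as soon as the limit is nonempty. An empty limit would force a
zero limit coupling, hence two zero marginals.

Limits are taken along arbitrary filters where possible, so that limit points can be treated as
ultrafilter limits. -/

namespace ZeroCoupling

/-! ### Cyclic monotonicity, Minty's condition and Fell limits. -/

section CyclicMonotonicity

variable {E : Type*} [NormedAddCommGroup E] [InnerProductSpace ℝ E]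

/-- A nonempty closed convex set above the graph of an affine function has a supporting affine
function whose slope `z - x` and base point `x` add up to a given `z`. -/
theorem exists_support_of_isClosed_convex [ProperSpace E] {C : Set (E × ℝ)} (hC : IsClosed C)
    (hconv : Convex ℝ C) (hne : C.Nonempty) {a : E} {b : ℝ}
    (hab : ∀ p ∈ C, inner ℝ p.1 a + b ≤ p.2) (z : E) :
    ∃ p ∈ C, ∀ q ∈ C, p.2 + inner ℝ (q.1 - p.1) (z - p.1) ≤ q.2 := by
  obtain ⟨s, hs⟩ := hne
  -- The point sought is the proximal point of `z`: the minimiser of height plus half the squared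
  -- distance.
  set g : E × ℝ → ℝ := fun p => p.2 + ‖p.1 - z‖ ^ 2 / 2 with hg
  have hgc : Continuous g := by fun_prop
  set S : Set (E × ℝ) := C ∩ {p | g p ≤ g s} with hS
  have hScl : IsClosed S := hC.inter (isClosed_le hgc continuous_const)
  -- Completing the square in the affine minorant gives `‖x - z + a‖ ^ 2 ≤ M` on the sublevel set,
  -- which is therefore bounded.
  set M : ℝ := 2 * g s - 2 * b - 2 * inner ℝ z a + ‖a‖ ^ 2 with hM
  have hSK : S ⊆ Metric.closedBall (0 : E) (M + 1 + ‖z - a‖) ×ˢ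
      Set.Icc (b - (M + 1 + ‖z - a‖) * ‖a‖) (g s) := by
    rintro ⟨x, r⟩ ⟨hxC, hx⟩
    have h1 := hab _ hxC
    simp only [Set.mem_ofPred_eq] at hx h1
    have hx' : r + ‖x - z‖ ^ 2 / 2 ≤ g s := hx
    have h2 : ‖x - z + a‖ ^ 2 ≤ M := by
      rw [norm_add_sq_real, inner_sub_left]
      linarith
    have h3 : ‖x - z + a‖ ≤ M + 1 := by nlinarith [sq_nonneg (‖x - z + a‖ - 1 / 2)]
    have h4 : ‖x‖ ≤ M + 1 + ‖z - a‖ := by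
      have : x = (x - z + a) + (z - a) := by abel
      calc ‖x‖ = ‖(x - z + a) + (z - a)‖ := by rw [← this]
        _ ≤ _ := (norm_add_le _ _).trans (by linarith)
    have h5 : -(‖x‖ * ‖a‖) ≤ inner ℝ x a := neg_le_of_abs_le (abs_real_inner_le_norm x a)
    refine ⟨by simpa using h4, ?_, ?_⟩
    · have := mul_le_mul_of_nonneg_right h4 (norm_nonneg a)
      simp only
      linarith
    · have := sq_nonneg ‖x - z‖
      simp only
      linarith
  have hScpt : IsCompact S :=
    ((isCompact_closedBall _ _).prod isCompact_Icc).of_isClosed_subset hScl hSK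
  obtain ⟨p, hpS, hp⟩ := hScpt.exists_isMinOn ⟨s, hs, le_refl (g s)⟩ hgc.continuousOn
  have hmin : ∀ q ∈ C, g p ≤ g q := by
    intro q hq
    by_cases h : g q ≤ g s
    · exact hp ⟨hq, h⟩
    · exact hpS.2.trans (not_le.1 h).le
  refine ⟨p, hpS.1, fun q hq => ?_⟩
  -- First variation along the segment from `p` to `q`: the increment of `g` at time `t` is `t * (A
  -- + t * B)`, so minimality gives `0 ≤ A` as `t → 0`.
  set A : ℝ := q.2 - p.2 + inner ℝ (p.1 - z) (q.1 - p.1) with hA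
  set B : ℝ := ‖q.1 - p.1‖ ^ 2 / 2 with hB
  have key : ∀ t : ℝ, 0 < t → t ≤ 1 → 0 ≤ A + t * B := by
    intro t ht ht1
    have hmem : p + t • (q - p) ∈ C := hconv.add_smul_sub_mem hpS.1 hq ⟨ht.le, ht1⟩
    have h := hmin _ hmem
    have e : g (p + t • (q - p)) = g p + t * (A + t * B) := by
      have : (p + t • (q - p)).1 - z = (p.1 - z) + t • (q.1 - p.1) := by
        simp only [Prod.fst_add, Prod.smul_fst, Prod.fst_sub]
        abel
      simp only [hg, this, norm_add_sq_real, norm_smul, inner_smul_right, hA, hB, mul_pow,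
        Real.norm_eq_abs, sq_abs, Prod.snd_add, Prod.smul_snd, Prod.snd_sub, smul_eq_mul]
      ring
    rw [e] at h
    exact nonneg_of_mul_nonneg_right (by linarith) ht
  have hA0 : 0 ≤ A := by
    have hlim : Tendsto (fun t : ℝ => A + t * B) (𝓝[>] 0) (𝓝 (A + 0 * B)) :=
      ((continuous_const.add (continuous_id.mul continuous_const)).tendsto 0).mono_left
        nhdsWithin_le_nhds
    have := ge_of_tendsto hlim (by
      filter_upwards [Ioc_mem_nhdsGT (zero_lt_one (α := ℝ))] with t ht using key t ht.1 ht.2)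
    simpa using this
  have e : inner ℝ (q.1 - p.1) (z - p.1) = -inner ℝ (p.1 - z) (q.1 - p.1) := by
    rw [← inner_neg_left, neg_sub, real_inner_comm]
  rw [e]
  linarith

/-- The value at `x` of the affine function attached to the chain `q 0, …, q n`. -/
noncomputable def chainValue (q : ℕ → E × E) (n : ℕ) (x : E) : ℝ :=
  inner ℝ (x - (q 0).1) (q 0).2 +
    ∑ i ∈ Finset.range n, inner ℝ ((q i).1 - (q (i + 1)).1) (q (i + 1)).2

/-- The epigraph of Rockafellar's potential of the set `T`, based at `p₀`. -/
def potentialEpigraph (T : Set (E × E)) (p₀ : E × E) : Set (E × ℝ) :=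
  {w | ∀ (n : ℕ) (q : ℕ → E × E), (∀ i, q i ∈ T) → q n = p₀ → chainValue q n w.1 ≤ w.2}

/-- Used twice: with `x` the base point it closes the chain into a cycle and bounds the potential;
with `x` free it gives the subgradient inequality at `p`. -/
theorem chainValue_cons (p : E × E) (q : ℕ → E × E) (n : ℕ) (x : E) :
    chainValue (fun i => Nat.casesOn i p q) (n + 1) x =
      inner ℝ (x - p.1) p.2 + chainValue q n p.1 := by
  simp only [chainValue, Finset.sum_range_succ']
  change inner ℝ (x - p.1) p.2 + (∑ i ∈ Finset.range n,
    inner ℝ ((q i).1 - (q (i + 1)).1) (q (i + 1)).2 + inner ℝ (p.1 - (q 0).1) (q 0).2) = _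
  ring

/-- The cyclic inequality written over `Finset.range`. -/
theorem IsCyclicallyMonotone.sum_range_le {T : Set (E × E)} (hT : IsCyclicallyMonotone T)
    (n : ℕ) (q : ℕ → E × E) (hq : ∀ i, q i ∈ T) :
    inner ℝ ((q n).1 - (q 0).1) (q 0).2 +
      ∑ i ∈ Finset.range n, inner ℝ ((q i).1 - (q (i + 1)).1) (q (i + 1)).2 ≤ 0 := by
  cases n with
  -- The definition starts at two points; for one point the inequality is `0 ≤ 0`.
  | zero => simp
  | succ n =>
    have h := hT n (fun i => q i) fun i => hq i
    have h1 : ∑ i : Fin (n + 2), inner ℝ (q i).1 (q ((i + 1 : Fin (n + 2)) : ℕ)).2 =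
        ∑ i ∈ Finset.range (n + 1), inner ℝ (q i).1 (q (i + 1)).2 +
          inner ℝ (q (n + 1)).1 (q 0).2 := by
      rw [Fin.sum_univ_castSucc, ← Fin.sum_univ_eq_sum_range]
      congr 1
      · refine Finset.sum_congr rfl fun i _ => ?_
        simp
      · simp
    have h2 : ∑ i : Fin (n + 2), inner ℝ (q i).1 (q i).2 =
        ∑ i ∈ Finset.range (n + 1), inner ℝ (q (i + 1)).1 (q (i + 1)).2 +
          inner ℝ (q 0).1 (q 0).2 := by
      rw [Fin.sum_univ_eq_sum_range (fun i => inner ℝ (q i).1 (q i).2), Finset.sum_range_succ']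
    simp only [inner_sub_left, Finset.sum_sub_distrib]
    rw [h1, h2] at h
    linarith

/-- A set is cyclically monotone as soon as its members are subgradients of one potential, given
by its epigraph. -/
theorem isCyclicallyMonotone_of_epigraph {T : Set (E × E)} {C : Set (E × ℝ)}
    (h : ∀ p ∈ T, ∃ r : ℝ, (p.1, r) ∈ C ∧ ∀ q ∈ C, r + inner ℝ (q.1 - p.1) p.2 ≤ q.2) :
    IsCyclicallyMonotone T := by
  intro n p hp
  choose r hr hle using fun i => h (p i) (hp i)
  -- The subgradient inequality at `p (i + 1)` tested at `p i`; summed over the cycle, the heights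
  -- `r` cancel.
  have key : ∀ i, inner ℝ (p i).1 (p (i + 1)).2 + r (i + 1) ≤
      inner ℝ (p (i + 1)).1 (p (i + 1)).2 + r i := by
    intro i
    have := hle (i + 1) _ (hr i)
    simp only [inner_sub_left] at this
    linarith
  have hsum := Finset.sum_le_sum fun i (_ : i ∈ Finset.univ) => key i
  rw [Finset.sum_add_distrib, Finset.sum_add_distrib] at hsum
  have e1 := Equiv.sum_comp (Equiv.addRight (1 : Fin (n + 2))) r
  have e2 := Equiv.sum_comp (Equiv.addRight (1 : Fin (n + 2))) fun i => inner ℝ (p i).1 (p i).2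
  simp only [Equiv.coe_addRight] at e1 e2
  linarith

theorem isCyclicallyMonotone_singleton (p : E × E) : IsCyclicallyMonotone {p} := by
  intro n q hq
  have : ∀ i, q i = p := hq
  simp [this]

theorem IsMaximalCyclicallyMonotone.nonempty {T : Set (E × E)}
    (hT : IsMaximalCyclicallyMonotone T) : T.Nonempty := by
  by_contra h
  rw [Set.not_nonempty_iff_eq_empty] at h
  have := hT.2 (isCyclicallyMonotone_singleton (0 : E × E)) (by simp [h]) rfl
  simp [h] at this

/-- Minty's condition holds for maximal cyclically monotone sets. -/
theorem IsMaximalCyclicallyMonotone.exists_add_eq [ProperSpace E] {T : Set (E × E)}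
    (hT : IsMaximalCyclicallyMonotone T) (z : E) : ∃ p ∈ T, p.1 + p.2 = z := by
  obtain ⟨p₀, hp₀⟩ := hT.nonempty
  set C := potentialEpigraph T p₀ with hCdef
  have hCeq : C = ⋂ (n : ℕ) (q : ℕ → E × E) (_ : ∀ i, q i ∈ T) (_ : q n = p₀),
      {w : E × ℝ | chainValue q n w.1 ≤ w.2} := by
    ext w
    simp [hCdef, potentialEpigraph]
  have hclosed : IsClosed C := by
    rw [hCeq]
    refine isClosed_iInter fun n => isClosed_iInter fun q => isClosed_iInter fun _ =>
      isClosed_iInter fun _ => isClosed_le ?_ continuous_snd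
    unfold chainValue
    fun_prop
  have hconv : Convex ℝ C := by
    rw [hCeq]
    refine convex_iInter fun n => convex_iInter fun q => convex_iInter fun _ =>
      convex_iInter fun _ => ?_
    rintro ⟨x, r⟩ hx ⟨y, s⟩ hy a b ha hb hab
    simp only [Set.mem_ofPred_eq, chainValue, inner_sub_left (𝕜 := ℝ) (z := (q 0).2)] at hx hy ⊢
    simp only [Prod.smul_mk, Prod.mk_add_mk, inner_add_left, inner_smul_left, smul_eq_mul,
      conj_trivial]
    set D := ∑ i ∈ Finset.range n, inner ℝ ((q i).1 - (q (i + 1)).1) (q (i + 1)).2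
    have h1 := mul_le_mul_of_nonneg_left hx ha
    have h2 := mul_le_mul_of_nonneg_left hy hb
    have h3 : b = 1 - a := by linarith
    subst h3
    nlinarith
  -- Each point of `T` is a subgradient of Rockafellar's potential, whose value there is `sSup V`.
  -- It is finite because a chain from `p₀` to `p` closes to a cycle in `T`. Working with the
  -- epigraph avoids infinite values elsewhere.
  have hsub : ∀ p ∈ T, ∃ r : ℝ, (p.1, r) ∈ C ∧ ∀ q ∈ C, r + inner ℝ (q.1 - p.1) p.2 ≤ q.2 := by
    intro p hp
    set V : Set ℝ := {v | ∃ (n : ℕ) (q : ℕ → E × E), (∀ i, q i ∈ T) ∧ q n = p₀ ∧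
      v = chainValue q n p.1} with hV
    have hVne : V.Nonempty := ⟨_, 0, fun _ => p₀, fun _ => hp₀, rfl, rfl⟩
    have hVbdd : ∀ v ∈ V, v ≤ inner ℝ (p.1 - p₀.1) p.2 := by
      rintro _ ⟨n, q, hq, hqn, rfl⟩
      have h := hT.1.sum_range_le (n + 1) (fun i => Nat.casesOn i p q)
        (fun i => by cases i <;> simp [hp, hq])
      have e := chainValue_cons p q n (q n).1
      simp only [chainValue] at e ⊢
      simp only at h
      rw [e, hqn] at h
      rw [← neg_sub p₀.1, inner_neg_left]
      linarith
    refine ⟨sSup V, fun n q hq hqn => le_csSup ⟨_, hVbdd⟩ ⟨n, q, hq, hqn, rfl⟩, ?_⟩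
    intro w hw
    have : sSup V ≤ w.2 - inner ℝ (w.1 - p.1) p.2 := by
      refine csSup_le hVne ?_
      rintro _ ⟨n, q, hq, hqn, rfl⟩
      have := hw (n + 1) (fun i => Nat.casesOn i p q)
        (fun i => by cases i <;> simp [hp, hq]) hqn
      rw [chainValue_cons] at this
      linarith
    linarith
  obtain ⟨r₀, hr₀, hr₀le⟩ := hsub p₀ hp₀
  obtain ⟨w, hwC, hw⟩ := exists_support_of_isClosed_convex hclosed hconv ⟨_, hr₀⟩
    (a := p₀.2) (b := r₀ - inner ℝ p₀.1 p₀.2) (fun q hq => by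
      have := hr₀le q hq
      rw [inner_sub_left] at this
      linarith) z
  -- The new pair is a subgradient of the same potential as the points of `T`, so maximality forces
  -- it into `T`.
  have hcm : IsCyclicallyMonotone (insert (w.1, z - w.1) T) := by
    refine isCyclicallyMonotone_of_epigraph (C := C) ?_
    rintro p (rfl | hp)
    · exact ⟨w.2, hwC, hw⟩
    · exact hsub p hp
  exact ⟨(w.1, z - w.1), hT.2 hcm (Set.subset_insert _ _) (Set.mem_insert _ _), by simp⟩

/-- Ordinary monotonicity is the case of cycles of length two. -/
theorem IsCyclicallyMonotone.inner_nonneg {T : Set (E × E)} (hT : IsCyclicallyMonotone T)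
    {p q : E × E} (hp : p ∈ T) (hq : q ∈ T) : 0 ≤ inner ℝ (p.1 - q.1) (p.2 - q.2) := by
  have h : ∑ i : Fin 2, inner ℝ (![p, q] i).1 (![p, q] (i + 1)).2 ≤
      ∑ i : Fin 2, inner ℝ (![p, q] i).1 (![p, q] i).2 :=
    hT 0 ![p, q] (fun i => by fin_cases i <;> simp [hp, hq])
  simp only [Fin.sum_univ_two, Matrix.cons_val_zero, Matrix.cons_val_one, zero_add,
    show (1 + 1 : Fin 2) = 0 from rfl] at h
  simp only [inner_sub_left, inner_sub_right]
  linarith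

/-- A cyclically monotone set that satisfies Minty's condition is maximal. -/
theorem IsCyclicallyMonotone.isMaximal {T : Set (E × E)} (hT : IsCyclicallyMonotone T)
    (hz : ∀ z, ∃ p ∈ T, p.1 + p.2 = z) : IsMaximalCyclicallyMonotone T := by
  refine ⟨hT, fun S hS hTS p hp => ?_⟩
  obtain ⟨q, hq, hqp⟩ := hz (p.1 + p.2)
  have h := hS.inner_nonneg hp (hTS hq)
  -- Equal sums turn monotonicity into `0 ≤ -‖p.1 - q.1‖ ^ 2`.
  have e : p.2 - q.2 = -(p.1 - q.1) := by
    rw [neg_sub, sub_eq_sub_iff_add_eq_add, add_comm, ← hqp]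
  rw [e, inner_neg_right, real_inner_self_eq_norm_sq] at h
  have h0 : p.1 - q.1 = 0 := by
    rw [← norm_eq_zero]
    nlinarith [norm_nonneg (p.1 - q.1)]
  have h1 : p = q := Prod.ext (sub_eq_zero.1 h0) (sub_eq_zero.1 (by rw [e, h0, neg_zero]))
  exact h1 ▸ hq

/-- Cyclic monotonicity passes to lower limits of sets. -/
theorem isCyclicallyMonotone_of_lowerLimit {ι : Type*} {l : Filter ι} [l.NeBot]
    {S : ι → Set (E × E)} {T : Set (E × E)} (hS : ∀ i, IsCyclicallyMonotone (S i))
    (h : ∀ G, IsOpen G → (T ∩ G).Nonempty → ∀ᶠ i in l, (S i ∩ G).Nonempty) :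
    IsCyclicallyMonotone T := by
  intro n p hp
  by_contra hlt
  rw [not_le] at hlt
  -- A violating family has a product neighbourhood of violating families, and the sets `S i`
  -- eventually meet each of its finitely many factors.
  have hopen : IsOpen {q : Fin (n + 2) → E × E | ∑ i, inner ℝ (q i).1 (q i).2 <
      ∑ i, inner ℝ (q i).1 (q (i + 1)).2} :=
    isOpen_lt (by fun_prop) (by fun_prop)
  obtain ⟨u, hu, hsub⟩ := isOpen_pi_iff'.1 hopen p hlt
  have hev : ∀ᶠ i in l, ∀ j, (S i ∩ u j).Nonempty :=
    eventually_all.2 fun j => h _ (hu j).1 ⟨p j, hp j, (hu j).2⟩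
  obtain ⟨i, hi⟩ := hev.exists
  choose q hq using hi
  exact absurd (hS i n q fun j => (hq j).1) (not_le.2 (hsub fun j _ => (hq j).2))

/-- Nonempty Fell limits of maximal cyclically monotone sets are maximal cyclically monotone. -/
theorem isMaximalCyclicallyMonotone_of_tendsto [ProperSpace E] {ι : Type*} {l : Filter ι}
    [l.NeBot] {S : ι → FellSpace (E × E)} {T : FellSpace (E × E)} (h : Tendsto S l (𝓝 T))
    (hS : ∀ i, IsMaximalCyclicallyMonotone (S i : Set (E × E)))
    (hT : (T : Set (E × E)).Nonempty) : IsMaximalCyclicallyMonotone (T : Set (E × E)) := by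
  rw [tendsto_fell_iff] at h
  refine (isCyclicallyMonotone_of_lowerLimit (fun i => (hS i).1) h.1).isMaximal fun z => ?_
  obtain ⟨p, hp⟩ := hT
  -- For `a ∈ S i` within `1` of `p` and the Minty solution `q`, `‖q.1‖ ≤ ‖a.1‖ + ‖z - (a.1 +
  -- a.2)‖`, which is at most `‖z‖` plus three norms bounded by `‖p‖ + 1`.
  set R : ℝ := ‖z‖ + 3 * (‖p‖ + 1) with hR
  set K : Set (E × E) := Metric.closedBall 0 (R + ‖z‖) ∩ {q | q.1 + q.2 = z} with hK
  have hKc : IsCompact K := (isCompact_closedBall _ _).inter_right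
    (isClosed_eq (by fun_prop) continuous_const)
  have hev : ∀ᶠ i in l, ((S i : Set (E × E)) ∩ K).Nonempty := by
    filter_upwards [h.1 (Metric.ball p 1) Metric.isOpen_ball ⟨p, hp, by simp⟩]
    rintro i ⟨a, ha, hap⟩
    obtain ⟨q, hq, hqz⟩ := (hS i).exists_add_eq z
    have h1 := (hS i).1.inner_nonneg hq ha
    have hna : ‖a‖ ≤ ‖p‖ + 1 := by
      rw [mem_ball_iff_norm] at hap
      have := norm_sub_norm_le a p
      linarith
    have hna1 := (norm_fst_le a).trans hna
    have hna2 := (norm_snd_le a).trans hna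
    -- The resolvent is nonexpansive: monotonicity gives `‖u‖ ^ 2 ≤ ⟪u, u + v⟫` for `u = q.1 - a.1`,
    -- `v = q.2 - a.2`.
    have h2 : ‖q.1 - a.1‖ ≤ ‖z - (a.1 + a.2)‖ := by
      have e : z - (a.1 + a.2) = (q.1 - a.1) + (q.2 - a.2) := by
        rw [← hqz]
        abel
      have h3 := real_inner_le_norm (q.1 - a.1) (z - (a.1 + a.2))
      rw [e, inner_add_right, real_inner_self_eq_norm_sq, ← e] at h3
      by_contra hc
      rw [not_le] at hc
      nlinarith [norm_nonneg (q.1 - a.1), norm_nonneg (z - (a.1 + a.2))]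
    have h4 : ‖q.1‖ ≤ R := by
      have h5 := norm_sub_norm_le q.1 a.1
      have h6 := norm_sub_le z (a.1 + a.2)
      have h7 := norm_add_le a.1 a.2
      linarith
    have h5 : ‖q.2‖ ≤ R + ‖z‖ := by
      have e : q.2 = z - q.1 := by rw [← hqz]; abel
      rw [e]
      have := norm_sub_le z q.1
      linarith
    refine ⟨q, hq, ?_, hqz⟩
    rw [mem_closedBall_zero_iff, Prod.norm_def]
    exact max_le (by linarith [norm_nonneg z]) h5
  by_contra hne
  have hempty : (T : Set (E × E)) ∩ K = ∅ := by
    rw [← Set.not_nonempty_iff_eq_empty]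
    rintro ⟨q, hq, -, hqz⟩
    exact hne ⟨q, hq, hqz⟩
  obtain ⟨i, hi1, hi2⟩ := (hev.and (h.2 K hKc hempty)).exists
  exact hi1.ne_empty hi2

end CyclicMonotonicity

end ZeroCoupling

namespace ZeroCoupling

/-! ### Test functions on the whole space. -/

section TestFunctions

variable {E : Type*} [NormedAddCommGroup E]

/-- The bounded continuous functions on `E` that vanish near the origin. -/
structure IsTest (F : E → ℝ) : Prop where
  continuous : Continuous F
  bounded : ∃ C, ∀ x, |F x| ≤ C
  eventually_zero : ∀ᶠ x in 𝓝 0, F x = 0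

/-- The extension by zero of a bounded continuous function that vanishes near the origin. -/
theorem exists_isTest_extension {f : Punctured E → ℝ} (hf : Continuous f) {C : ℝ}
    (hC : ∀ x, |f x| ≤ C) {U : Set E} (hU : U ∈ 𝓝 0)
    (hfU : ∀ x : Punctured E, (x : E) ∈ U → f x = 0) :
    ∃ F : E → ℝ, IsTest F ∧ ∀ x : Punctured E, F x = f x := by
  set F : E → ℝ := Function.extend Subtype.val f 0
  have hval : ∀ x : Punctured E, F x = f x := fun x =>
    Subtype.val_injective.extend_apply f 0 x
  have hzero : F 0 = 0 := by
    refine (Function.extend_apply' _ _ _ ?_).trans rfl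
    rintro ⟨x, hx⟩
    exact x.2 hx
  have hev : ∀ᶠ x in 𝓝 (0 : E), F x = 0 := by
    filter_upwards [hU] with x hx
    by_cases h0 : x = 0
    · rw [h0, hzero]
    · rw [← hfU ⟨x, h0⟩ hx, ← hval]
  refine ⟨F, ⟨continuous_iff_continuousAt.2 fun x => ?_, ⟨max C 0, fun x => ?_⟩, hev⟩, hval⟩
  · by_cases h0 : x = 0
    · subst h0
      exact (continuousAt_congr hev).2 continuousAt_const
    · have hemb : IsOpenEmbedding (Subtype.val : Punctured E → E) :=
        isOpen_ne.isOpenEmbedding_subtypeVal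
      refine (hemb.continuousAt_iff (x := ⟨x, h0⟩)).1 ?_
      have : F ∘ Subtype.val = f := funext hval
      rw [this]
      exact hf.continuousAt
  · by_cases h0 : x = 0
    · rw [h0, hzero, abs_zero]
      exact le_max_right _ _
    · rw [hval ⟨x, h0⟩]
      exact (hC _).trans (le_max_left _ _)

/-- The extension by zero of a compactly supported function on the punctured space. -/
theorem exists_isTest_of_compactlySupported (f : CompactlySupportedContinuousMap (Punctured E) ℝ) :
    ∃ F : E → ℝ, IsTest F ∧ ∀ x : Punctured E, F x = f x := by
  have hK : IsCompact (Subtype.val '' tsupport f) :=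
    (show IsCompact (tsupport f) from f.hasCompactSupport).image continuous_subtype_val
  have hU : (Subtype.val '' tsupport f)ᶜ ∈ 𝓝 (0 : E) := by
    refine hK.isClosed.isOpen_compl.mem_nhds ?_
    rintro ⟨x, -, hx⟩
    exact x.2 hx
  obtain ⟨C, hC⟩ := f.hasCompactSupport.exists_bound_of_continuous f.continuous
  exact exists_isTest_extension f.continuous hC hU fun x hx =>
    image_eq_zero_of_notMem_tsupport fun h => hx ⟨_, h, rfl⟩

theorem IsTest.add {F G : E → ℝ} (hF : IsTest F) (hG : IsTest G) : IsTest (fun x => F x + G x) := by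
  obtain ⟨C, hC⟩ := hF.bounded
  obtain ⟨D, hD⟩ := hG.bounded
  refine ⟨hF.continuous.add hG.continuous, ⟨C + D, fun x =>
    (abs_add_le _ _).trans (add_le_add (hC x) (hD x))⟩, ?_⟩
  filter_upwards [hF.eventually_zero, hG.eventually_zero] with x h1 h2
  rw [h1, h2, add_zero]

theorem IsTest.const_mul {F : E → ℝ} (hF : IsTest F) (c : ℝ) : IsTest (fun x => c * F x) := by
  obtain ⟨C, hC⟩ := hF.bounded
  refine ⟨continuous_const.mul hF.continuous, ⟨|c| * C, fun x => ?_⟩, ?_⟩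
  · rw [abs_mul]
    exact mul_le_mul_of_nonneg_left (hC x) (abs_nonneg c)
  · filter_upwards [hF.eventually_zero] with x h1
    rw [h1, mul_zero]

/-- This is why marginals pass to the limit: test functions need not have bounded support, so none
of the mass along the other coordinate is lost. -/
theorem IsTest.comp_fst {F : E → ℝ} (hF : IsTest F) : IsTest (fun z : E × E => F z.1) :=
  ⟨hF.continuous.comp continuous_fst, hF.bounded.imp fun _ hC z => hC z.1,
    (continuous_fst.tendsto (0 : E × E)).eventually hF.eventually_zero⟩

theorem IsTest.comp_snd {F : E → ℝ} (hF : IsTest F) : IsTest (fun z : E × E => F z.2) :=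
  ⟨hF.continuous.comp continuous_snd, hF.bounded.imp fun _ hC z => hC z.2,
    (continuous_snd.tendsto (0 : E × E)).eventually hF.eventually_zero⟩

theorem tendsto_mZero_iff_isTest [MeasurableSpace E] {ι : Type*} {l : Filter ι} {u : ι → MZero E}
    {μ : MZero E} :
    Tendsto u l (𝓝 μ) ↔ ∀ F : E → ℝ, IsTest F →
      Tendsto (fun i => ∫ x, F x ∂(u i).toMeasure) l (𝓝 (∫ x, F x ∂μ.toMeasure)) := by
  rw [tendsto_mZero_iff]
  constructor
  · intro h F hF
    obtain ⟨C, hC⟩ := hF.bounded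
    exact h ⟨BoundedContinuousFunction.ofNormedAddCommGroup (fun x : Punctured E => F x)
      (hF.continuous.comp continuous_subtype_val) C fun x => hC x,
      {x | F x = 0}, hF.eventually_zero, fun x hx => hx⟩
  · rintro h ⟨f, U, hU, hfU⟩
    obtain ⟨F, hF, hval⟩ := exists_isTest_extension f.continuous
      (fun x => f.norm_coe_le_norm x) hU hfU
    simpa only [hval] using h F hF

theorem nullExtension_apply [MeasurableSpace E] (μ : Measure (Punctured E)) {s : Set E}
    (hs : MeasurableSet s) : nullExtension μ s = μ (Subtype.val ⁻¹' s) :=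
  Measure.map_apply measurable_subtype_coe hs

variable [MeasurableSpace E] [BorelSpace E]

/-- A bounded function is integrable here because the set where it is nonzero stays away from the
origin and so has finite mass. -/
theorem IsTest.integrable {F : E → ℝ} (hF : IsTest F) {μ : Measure (Punctured E)}
    (hμ : FiniteAwayFromZero μ) : Integrable (fun x : Punctured E => F x) μ := by
  obtain ⟨C, hC⟩ := hF.bounded
  have hcont : Continuous fun x : Punctured E => F x := hF.continuous.comp continuous_subtype_val
  set S : Set (Punctured E) := {x | F x ≠ 0}
  have hS : MeasurableSet S := (isOpen_ne_fun hcont continuous_const).measurableSet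
  have hfin : μ S < ⊤ := by
    refine hμ S hS fun h => ?_
    obtain ⟨x, hx0, ⟨y, hy, rfl⟩⟩ := mem_closure_iff_nhds.1 h _ hF.eventually_zero
    exact hy hx0
  have hon : IntegrableOn (fun x : Punctured E => F x) S μ :=
    Measure.integrableOn_of_bounded hfin.ne hcont.aestronglyMeasurable
      (M := C) (Eventually.of_forall fun x => hC x)
  exact (integrableOn_iff_integrable_of_support_subset fun x hx => hx).1 hon

/-- A measure finite away from the origin is finite on compact sets. -/
theorem FiniteAwayFromZero.isFiniteMeasureOnCompacts {μ : Measure (Punctured E)}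
    (hμ : FiniteAwayFromZero μ) : IsFiniteMeasureOnCompacts μ := by
  refine ⟨fun K hK => hμ K hK.measurableSet ?_⟩
  rw [(hK.image continuous_subtype_val).isClosed.closure_eq]
  rintro ⟨x, -, hx⟩
  exact x.2 hx

instance [ProperSpace E] : LocallyCompactSpace (Punctured E) :=
  (isOpen_ne (x := (0 : E))).locallyCompactSpace

/-- Measures finite away from the origin are determined by the integrals of test functions. -/
theorem FiniteAwayFromZero.ext_of_integral_isTest [ProperSpace E] {μ ν : Measure (Punctured E)}
    (hμ : FiniteAwayFromZero μ) (hν : FiniteAwayFromZero ν)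
    (h : ∀ F : E → ℝ, IsTest F → ∫ x : Punctured E, F x ∂μ = ∫ x : Punctured E, F x ∂ν) :
    μ = ν := by
  have := hμ.isFiniteMeasureOnCompacts
  have := hν.isFiniteMeasureOnCompacts
  refine Measure.ext_of_integral_eq_on_compactlySupported fun f => ?_
  obtain ⟨F, hF, hval⟩ := exists_isTest_of_compactlySupported f
  simpa only [hval] using h F hF

end TestFunctions

/-! ### Marginals and limits of zero-couplings. -/

section Couplings

variable {E : Type*} [NormedAddCommGroup E] [MeasurableSpace E] [BorelSpace E]

/-- The condition `F 0 = 0` removes the mass of `γ` on `{0} × E`, which the zero-marginal ignores.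
-/
theorem integral_leftMarginal [SecondCountableTopology E] (γ : Measure (Punctured (E × E)))
    {F : E → ℝ} (hF : Continuous F) (h0 : F 0 = 0) :
    ∫ x : Punctured E, F x ∂(leftMarginal γ) = ∫ z, F z.1.1 ∂γ := by
  have emb : MeasurableEmbedding (Subtype.val : Punctured E → E) :=
    MeasurableEmbedding.subtype_coe (measurableSet_singleton 0).compl
  rw [leftMarginal, ← emb.integral_map (g := F), emb.map_comap,
    setIntegral_eq_integral_of_forall_compl_eq_zero, integral_map]
  · exact (measurable_fst.comp measurable_subtype_coe).aemeasurable
  · exact hF.aestronglyMeasurable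
  · intro x hx
    by_contra hne
    exact hx ⟨⟨x, fun h => hne (h ▸ h0)⟩, rfl⟩

theorem integral_rightMarginal [SecondCountableTopology E] (γ : Measure (Punctured (E × E)))
    {F : E → ℝ} (hF : Continuous F) (h0 : F 0 = 0) :
    ∫ x : Punctured E, F x ∂(rightMarginal γ) = ∫ z, F z.1.2 ∂γ := by
  have emb : MeasurableEmbedding (Subtype.val : Punctured E → E) :=
    MeasurableEmbedding.subtype_coe (measurableSet_singleton 0).compl
  rw [rightMarginal, ← emb.integral_map (g := F), emb.map_comap,
    setIntegral_eq_integral_of_forall_compl_eq_zero, integral_map]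
  · exact (measurable_snd.comp measurable_subtype_coe).aemeasurable
  · exact hF.aestronglyMeasurable
  · intro x hx
    by_contra hne
    exact hx ⟨⟨x, fun h => hne (h ▸ h0)⟩, rfl⟩

theorem FiniteAwayFromZero.leftMarginal {γ : Measure (Punctured (E × E))}
    (hγ : FiniteAwayFromZero γ) : FiniteAwayFromZero (leftMarginal γ) := by
  intro A hA hA0
  have emb : MeasurableEmbedding (Subtype.val : Punctured E → E) :=
    MeasurableEmbedding.subtype_coe (measurableSet_singleton 0).compl
  rw [leftMarginal_apply γ hA]
  refine hγ _ ((measurable_fst.comp measurable_subtype_coe) (emb.measurableSet_image' hA))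
    fun h => hA0 ?_
  refine map_mem_closure (f := fun z : E × E => z.1) continuous_fst h ?_
  rintro _ ⟨z, hz, rfl⟩
  exact hz

theorem FiniteAwayFromZero.rightMarginal {γ : Measure (Punctured (E × E))}
    (hγ : FiniteAwayFromZero γ) : FiniteAwayFromZero (rightMarginal γ) := by
  intro A hA hA0
  have emb : MeasurableEmbedding (Subtype.val : Punctured E → E) :=
    MeasurableEmbedding.subtype_coe (measurableSet_singleton 0).compl
  rw [rightMarginal_apply γ hA]
  refine hγ _ ((measurable_snd.comp measurable_subtype_coe) (emb.measurableSet_image' hA))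
    fun h => hA0 ?_
  refine map_mem_closure (f := fun z : E × E => z.2) continuous_snd h ?_
  rintro _ ⟨z, hz, rfl⟩
  exact hz

/-- Limits of zero-couplings are zero-couplings of the limits. -/
theorem mem_zeroCouplings_of_tendsto [ProperSpace E] {ι : Type*} {l : Filter ι} [l.NeBot]
    {μs νs : ι → MZero E} {μ ν : MZero E} {γs : ι → MZero (E × E)} {γ : MZero (E × E)}
    (hγ : Tendsto γs l (𝓝 γ)) (hμ : Tendsto μs l (𝓝 μ)) (hν : Tendsto νs l (𝓝 ν))
    (h : ∀ i, γs i ∈ zeroCouplings (μs i) (νs i)) : γ ∈ zeroCouplings μ ν := by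
  rw [tendsto_mZero_iff_isTest] at hγ hμ hν
  refine ⟨γ.finite_away.leftMarginal.ext_of_integral_isTest μ.finite_away fun F hF => ?_,
    γ.finite_away.rightMarginal.ext_of_integral_isTest ν.finite_away fun F hF => ?_⟩
  · rw [integral_leftMarginal _ hF.continuous hF.eventually_zero.self_of_nhds]
    refine tendsto_nhds_unique (hγ _ hF.comp_fst) ((hμ F hF).congr fun i => ?_)
    rw [← (h i).1, integral_leftMarginal _ hF.continuous hF.eventually_zero.self_of_nhds]
  · rw [integral_rightMarginal _ hF.continuous hF.eventually_zero.self_of_nhds]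
    refine tendsto_nhds_unique (hγ _ hF.comp_snd) ((hν F hF).congr fun i => ?_)
    rw [← (h i).2, integral_rightMarginal _ hF.continuous hF.eventually_zero.self_of_nhds]

end Couplings

/-! ### Semicontinuity of supports. -/

section Support

variable {E : Type*} [NormedAddCommGroup E] [MeasurableSpace E] [BorelSpace E]

/-- An open set that meets the support of the limit eventually meets the supports. -/
theorem eventually_support_inter_nonempty [SecondCountableTopology E] {ι : Type*} {l : Filter ι}
    {γs : ι → MZero E} {γ : MZero E} (hγ : Tendsto γs l (𝓝 γ)) (G : Set E) (hG : IsOpen G)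
    (h : (γ.support ∩ G).Nonempty) : ∀ᶠ i in l, ((γs i).support ∩ G).Nonempty := by
  rw [tendsto_mZero_iff_isTest] at hγ
  obtain ⟨z, hz, hzG⟩ := h
  have hpos : 0 < γ.toMeasure (Subtype.val ⁻¹' G) := by
    rw [← nullExtension_apply _ hG.measurableSet]
    exact (Measure.mem_support_iff_forall z).1 hz G (hG.mem_nhds hzG)
  -- The point `z` may be the origin, so `G` is exhausted, up to `0`, by open sets that test
  -- functions can see; one of them has positive mass.
  set W : ℕ → Set E := fun k => G ∩ {x | 1 / ((k : ℝ) + 1) < ‖x‖} with hW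
  have hWo : ∀ k, IsOpen (W k) := fun k => hG.inter (isOpen_lt continuous_const continuous_norm)
  obtain ⟨k, hk⟩ : ∃ k, 0 < γ.toMeasure (Subtype.val ⁻¹' W k) := by
    by_contra! hcon
    refine hpos.ne' (measure_mono_null ?_
      (measure_iUnion_null fun k => le_antisymm (hcon k) zero_le))
    intro x hx
    obtain ⟨k, hk⟩ := exists_nat_one_div_lt (norm_pos_iff.2 x.2)
    exact Set.mem_iUnion.2 ⟨k, hx, hk⟩
  have h0W : (0 : E) ∈ (W k)ᶜ := by
    rintro ⟨-, h0⟩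
    rw [Set.mem_ofPred_eq, norm_zero] at h0
    exact absurd h0 (not_lt.2 (by positivity))
  -- A test function positive exactly on `W k`: positivity of its integral is positivity of the mass
  -- of `W k`.
  set F : E → ℝ := fun x => min 1 (Metric.infDist x (W k)ᶜ) with hF
  have hF0 : ∀ x, 0 ≤ F x := fun x => le_min zero_le_one Metric.infDist_nonneg
  have hFsupp : ∀ x, F x ≠ 0 ↔ x ∈ W k := by
    intro x
    rw [← not_iff_not, not_not, ← Set.mem_compl_iff,
      (hWo k).isClosed_compl.mem_iff_infDist_zero ⟨0, h0W⟩]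
    constructor
    · intro hx
      rcases min_choice 1 (Metric.infDist x (W k)ᶜ) with h1 | h1
      · simp only [hF, h1, one_ne_zero] at hx
      · rw [← h1]
        exact hx
    · intro hx
      simp [hF, hx]
  have hFt : IsTest F := by
    refine ⟨continuous_const.min (Metric.continuous_infDist_pt _), ⟨1, fun x => ?_⟩, ?_⟩
    · rw [abs_of_nonneg (hF0 x)]
      exact min_le_left _ _
    · filter_upwards [Metric.ball_mem_nhds (0 : E) (ε := 1 / ((k : ℝ) + 1)) (by positivity)]
        with x hx
      by_contra hne
      have := ((hFsupp x).1 hne).2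
      rw [mem_ball_zero_iff] at hx
      exact lt_asymm hx this
  have hiff : ∀ η : MZero E, 0 < ∫ x, F x ∂η.toMeasure ↔
      0 < η.toMeasure (Subtype.val ⁻¹' W k) := by
    intro η
    rw [integral_pos_iff_support_of_nonneg (f := fun x : Punctured E => F x) (fun x => hF0 x) (hFt.integrable η.finite_away)]
    have : Function.support (fun x : Punctured E => F x) = Subtype.val ⁻¹' W k := by
      ext x
      exact hFsupp x
    rw [this]
  filter_upwards [(hγ F hFt).eventually (lt_mem_nhds ((hiff γ).2 hk))] with i hi
  have h1 := (hiff _).1 hi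
  rw [← nullExtension_apply _ (hWo k).measurableSet] at h1
  obtain ⟨x, hx, hxs⟩ := Measure.nonempty_inter_support_of_pos h1
  exact ⟨x, hxs, hx.1⟩

/-- Inclusions of supports in closed sets pass to the limit. -/
theorem support_subset_of_tendsto [ProperSpace E] {ι : Type*} {l : Filter ι} [l.NeBot]
    {γs : ι → MZero E} {γ : MZero E} {Ts : ι → FellSpace E} {T : FellSpace E}
    (hγ : Tendsto γs l (𝓝 γ)) (hT : Tendsto Ts l (𝓝 T))
    (h : ∀ i, (γs i).support ⊆ Ts i) : γ.support ⊆ T := by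
  intro z hz
  by_contra hzT
  have hTc : IsClosed (T : Set E) := TopologicalSpace.Closeds.isClosed T
  obtain ⟨r, hr, hrT⟩ := Metric.nhds_basis_closedBall.mem_iff.1 (hTc.isOpen_compl.mem_nhds hzT)
  have h1 := (tendsto_fell_iff.1 hT).2 _ (isCompact_closedBall z r)
    (Set.disjoint_iff_inter_eq_empty.1 (Set.disjoint_left.2 fun x hx hx' => hrT hx' hx))
  have h2 := eventually_support_inter_nonempty hγ (Metric.ball z r) Metric.isOpen_ball
    ⟨z, hz, Metric.mem_ball_self hr⟩
  obtain ⟨i, hi1, x, hx, hxz⟩ := (h1.and h2).exists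
  exact Set.notMem_empty x (hi1 ▸ ⟨h i hx, Metric.ball_subset_closedBall hxz⟩)

end Support

end ZeroCoupling

namespace ZeroCoupling

/-! ### Cutoffs and tails at infinity. -/

section Cutoff

variable {E : Type*} [NormedAddCommGroup E]

/-- A continuous cutoff that vanishes for `‖x‖ ≤ R / 2` and is `1` for `‖x‖ ≥ R`. -/
noncomputable def farCutoff (R : ℝ) (x : E) : ℝ := max 0 (min 1 (2 * ‖x‖ / R - 1))

theorem farCutoff_nonneg (R : ℝ) (x : E) : 0 ≤ farCutoff R x := le_max_left _ _

theorem farCutoff_le_one (R : ℝ) (x : E) : farCutoff R x ≤ 1 :=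
  max_le zero_le_one (min_le_left _ _)

theorem continuous_farCutoff (R : ℝ) : Continuous (farCutoff R : E → ℝ) := by
  unfold farCutoff
  fun_prop

theorem farCutoff_eq_one {R : ℝ} (hR : 0 < R) {x : E} (hx : R ≤ ‖x‖) : farCutoff R x = 1 := by
  have : 1 ≤ 2 * ‖x‖ / R - 1 := by
    rw [le_sub_iff_add_le, le_div_iff₀ hR]
    linarith
  rw [farCutoff, min_eq_left this, max_eq_right zero_le_one]

theorem farCutoff_eq_zero {R : ℝ} (hR : 0 < R) {x : E} (hx : ‖x‖ ≤ R / 2) :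
    farCutoff R x = 0 := by
  have : 2 * ‖x‖ / R - 1 ≤ 0 := by
    rw [sub_nonpos, div_le_one hR]
    linarith
  exact max_eq_left ((min_le_right _ _).trans this)

theorem farCutoff_anti {R S : ℝ} (hR : 0 < R) (hRS : R ≤ S) (x : E) :
    farCutoff S x ≤ farCutoff R x := by
  unfold farCutoff
  gcongr

theorem isTest_farCutoff {R : ℝ} (hR : 0 < R) : IsTest (farCutoff R : E → ℝ) := by
  refine ⟨continuous_farCutoff R, ⟨1, fun x => ?_⟩, ?_⟩
  · rw [abs_of_nonneg (farCutoff_nonneg R x)]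
    exact farCutoff_le_one R x
  · filter_upwards [Metric.ball_mem_nhds (0 : E) (half_pos hR)] with x hx
    exact farCutoff_eq_zero hR (mem_ball_zero_iff.1 hx).le

/-- The norm on the product is the maximum, so the left side equals one of the terms on the right.
Tightness of the marginals thereby passes to couplings. -/
theorem farCutoff_prod_le (R : ℝ) (z : E × E) :
    farCutoff R z ≤ farCutoff R z.1 + farCutoff R z.2 := by
  have key : ∀ w : E, ‖z‖ = ‖w‖ → farCutoff R z = farCutoff R w := by
    intro w hw
    rw [farCutoff, farCutoff, hw]
  rcases max_choice ‖z.1‖ ‖z.2‖ with h | h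
  · rw [key z.1 ((Prod.norm_def z).trans h)]
    linarith [farCutoff_nonneg R z.2]
  · rw [key z.2 ((Prod.norm_def z).trans h)]
    linarith [farCutoff_nonneg R z.1]

/-- Multiplication by cutoffs turns a continuous function into a test function. -/
theorem isTest_mul_cutoffs [ProperSpace E] {G : E → ℝ} (hG : Continuous G) {r S : ℝ} (hr : 0 < r)
    (hS : 0 < S) : IsTest fun x => G x * (farCutoff r x * (1 - farCutoff S x)) := by
  obtain ⟨C, hC⟩ := (isCompact_closedBall (0 : E) S).exists_bound_of_continuousOn hG.continuousOn
  have hC0 : 0 ≤ C := (norm_nonneg _).trans (hC 0 (by simp [hS.le]))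
  refine ⟨hG.mul ((continuous_farCutoff r).mul (continuous_const.sub (continuous_farCutoff S))),
    ⟨C, fun x => ?_⟩, ?_⟩
  · rcases le_total ‖x‖ S with hx | hx
    · have h1 : |farCutoff r x * (1 - farCutoff S x)| ≤ 1 := by
        rw [abs_of_nonneg (mul_nonneg (farCutoff_nonneg r x)
          (sub_nonneg.2 (farCutoff_le_one S x)))]
        exact mul_le_one₀ (farCutoff_le_one r x) (sub_nonneg.2 (farCutoff_le_one S x))
          (by linarith [farCutoff_nonneg S x])
      rw [abs_mul]
      exact (mul_le_of_le_one_right (abs_nonneg _) h1).trans (hC x (by simpa using hx))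
    · rw [farCutoff_eq_one hS hx]
      simpa using hC0
  · filter_upwards [(isTest_farCutoff hr).eventually_zero] with x hx
    rw [hx, zero_mul, mul_zero]

/-- Closed annuli are compact in the punctured space. -/
theorem isCompact_punctured_annulus [ProperSpace E] {δ : ℝ} (hδ : 0 < δ) (S : ℝ) :
    IsCompact {x : Punctured E | δ ≤ ‖(x : E)‖ ∧ ‖(x : E)‖ ≤ S} := by
  have e : {x : Punctured E | δ ≤ ‖(x : E)‖ ∧ ‖(x : E)‖ ≤ S} =
      Subtype.val ⁻¹' (Metric.closedBall (0 : E) S \ Metric.ball 0 δ) := by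
    ext x
    simp [and_comm]
  rw [e]
  refine (Topology.IsInducing.subtypeVal.isCompact_preimage_iff ?_).2
    ((isCompact_closedBall _ _).diff Metric.isOpen_ball)
  rintro x ⟨-, hx⟩
  refine ⟨⟨x, ?_⟩, rfl⟩
  rintro rfl
  exact hx (Metric.mem_ball_self hδ)

/-- The truncation of a test function at infinity has compact support in the punctured space. -/
theorem IsTest.exists_truncation [ProperSpace E] {F : E → ℝ} (hF : IsTest F) {S : ℝ}
    (hS : 0 < S) : ∃ f : CompactlySupportedContinuousMap (Punctured E) ℝ,
      ∀ x : Punctured E, f x = F x * (1 - farCutoff S (x : E)) := by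
  obtain ⟨δ, hδ, hball⟩ := Metric.eventually_nhds_iff_ball.1 hF.eventually_zero
  refine ⟨⟨⟨fun x => F x * (1 - farCutoff S (x : E)), ?_⟩, ?_⟩, fun x => rfl⟩
  · exact (hF.continuous.comp continuous_subtype_val).mul
      (continuous_const.sub ((continuous_farCutoff S).comp continuous_subtype_val))
  · refine HasCompactSupport.intro (isCompact_punctured_annulus hδ S) fun x hx => ?_
    change F x * (1 - farCutoff S (x : E)) = 0
    rcases lt_or_ge ‖(x : E)‖ δ with h1 | h1
    · rw [hball x (by simpa using h1), zero_mul]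
    · have h2 : S ≤ ‖(x : E)‖ := by
        by_contra hlt
        exact hx ⟨h1, (not_le.1 hlt).le⟩
      rw [farCutoff_eq_one hS h2, sub_self, mul_zero]

variable [MeasurableSpace E] [BorelSpace E]

theorem tendsto_integral_farCutoff {μ : Measure (Punctured E)} (hμ : FiniteAwayFromZero μ) :
    Tendsto (fun n : ℕ => ∫ x : Punctured E, farCutoff ((n : ℝ) + 1) (x : E) ∂μ) atTop (𝓝 0) := by
  have := tendsto_integral_of_dominated_convergence (μ := μ)
    (F := fun (n : ℕ) (x : Punctured E) => farCutoff ((n : ℝ) + 1) (x : E)) (f := fun _ => 0)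
    (fun x : Punctured E => farCutoff 1 (x : E))
    (fun n => ((continuous_farCutoff _).comp continuous_subtype_val).aestronglyMeasurable)
    ((isTest_farCutoff one_pos).integrable hμ)
    (fun n => Eventually.of_forall fun x => by
      rw [Real.norm_of_nonneg (farCutoff_nonneg _ _)]
      exact farCutoff_anti one_pos (by linarith [(n.cast_nonneg : (0 : ℝ) ≤ n)]) _)
    (Eventually.of_forall fun x => by
      obtain ⟨N, hN⟩ := exists_nat_ge (2 * ‖(x : E)‖)
      refine tendsto_const_nhds.congr' ?_
      filter_upwards [eventually_ge_atTop N] with n hn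
      have : (N : ℝ) ≤ n := by exact_mod_cast hn
      exact (farCutoff_eq_zero (by positivity) (by linarith)).symm)
  simpa using this

/-- Domination of test functions gives domination of integrals. -/
theorem abs_integral_sub_le {μ : Measure (Punctured E)} (hμ : FiniteAwayFromZero μ)
    {F G H : E → ℝ} (hF : IsTest F) (hG : IsTest G) (hH : IsTest H)
    (h : ∀ x, |F x - G x| ≤ H x) :
    |∫ x : Punctured E, F x ∂μ - ∫ x : Punctured E, G x ∂μ| ≤ ∫ x : Punctured E, H x ∂μ := by
  rw [← integral_sub (hF.integrable hμ) (hG.integrable hμ)]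
  exact norm_integral_le_of_norm_le (f := fun x : Punctured E => F x - G x) (hH.integrable hμ) (Eventually.of_forall fun x => h x)

end Cutoff

/-! ### Sequential compactness of zero-couplings. -/

section Compactness

variable {E : Type*} [NormedAddCommGroup E] [ProperSpace E] [MeasurableSpace E] [BorelSpace E]

/-- A real sequence that is uniformly approximated by convergent sequences converges. -/
theorem exists_tendsto_of_approx {a : ℕ → ℝ}
    (h : ∀ ε > 0, ∃ b : ℕ → ℝ, (∃ L, Tendsto b atTop (𝓝 L)) ∧ ∀ᶠ n in atTop, |a n - b n| ≤ ε) :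
    ∃ L, Tendsto a atTop (𝓝 L) := by
  refine cauchySeq_tendsto_of_complete (Metric.cauchySeq_iff'.2 fun ε hε => ?_)
  -- Passing from `a n` to `b n`, `L`, `b N`, `a N` costs four errors of size at most `ε / 5`.
  obtain ⟨b, ⟨L, hL⟩, hab⟩ := h (ε / 5) (by positivity)
  obtain ⟨N, hN⟩ := eventually_atTop.1
    (hab.and (Metric.tendsto_nhds.1 hL (ε / 5) (by positivity)))
  refine ⟨N, fun n hn => ?_⟩
  obtain ⟨h1, h2⟩ := hN n hn
  obtain ⟨h3, h4⟩ := hN N le_rfl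
  rw [Real.dist_eq] at *
  rw [abs_le] at h1 h3
  rw [abs_lt] at *
  constructor <;> linarith

/-- A sequence in `M₀(E)` that is bounded away from the origin and tight at infinity has a
subsequence along which the integrals of all test functions converge. -/
theorem exists_subseq_forall_integral_tendsto {γs : ℕ → MZero E}
    (hM : ∀ R : ℝ, 0 < R → ∃ M : ℝ, ∀ n,
      ∫ x : Punctured E, farCutoff R (x : E) ∂(γs n).toMeasure ≤ M)
    (hε : ∀ ε : ℝ, 0 < ε → ∃ R : ℝ, 0 < R ∧ ∀ᶠ n in atTop,
      ∫ x : Punctured E, farCutoff R (x : E) ∂(γs n).toMeasure ≤ ε) :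
    ∃ φ : ℕ → ℕ, StrictMono φ ∧ ∀ F : E → ℝ, IsTest F →
      ∃ L, Tendsto (fun k => ∫ x, F x ∂(γs (φ k)).toMeasure) atTop (𝓝 L) := by
  -- The products `g k * χ j` form a countable family of test functions that approximates every test
  -- function, up to its tail at infinity.
  set g : ℕ → C(E, ℝ) := TopologicalSpace.denseSeq C(E, ℝ)
  set χ : ℕ → E → ℝ := fun j x =>
    farCutoff (1 / ((j : ℝ) + 1)) x * (1 - farCutoff ((j : ℝ) + 1) x) with hχ
  have hpos : ∀ j : ℕ, (0 : ℝ) < 1 / ((j : ℝ) + 1) := fun j => by positivity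
  have hpos' : ∀ j : ℕ, (0 : ℝ) < (j : ℝ) + 1 := fun j => by positivity
  have hχ0 : ∀ j x, 0 ≤ χ j x := fun j x =>
    mul_nonneg (farCutoff_nonneg _ _) (sub_nonneg.2 (farCutoff_le_one _ _))
  have hχle : ∀ j x, χ j x ≤ farCutoff (1 / ((j : ℝ) + 1)) x := fun j x =>
    mul_le_of_le_one_right (farCutoff_nonneg _ _) (by linarith [farCutoff_nonneg ((j : ℝ) + 1) x])
  have hχfar : ∀ (j : ℕ) x, (j : ℝ) + 1 ≤ ‖x‖ → χ j x = 0 := fun j x hx => by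
    simp only [hχ]
    rw [farCutoff_eq_one (hpos' j) hx, sub_self, mul_zero]
  have hGt : ∀ k j, IsTest fun x => g k x * χ j x := fun k j =>
    isTest_mul_cutoffs (g k).continuous (hpos j) (hpos' j)
  have hzero : IsTest fun _ : E => (0 : ℝ) :=
    ⟨continuous_const, ⟨0, by simp⟩, Eventually.of_forall fun _ => rfl⟩
  have hbdd : ∀ i : ℕ × ℕ, ∃ B : ℝ, ∀ n,
      ∫ x, g i.1 x * χ i.2 x ∂(γs n).toMeasure ∈ Set.Icc (-B) B := by
    rintro ⟨k, j⟩
    obtain ⟨M, hM⟩ := hM _ (hpos j)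
    obtain ⟨C, hC⟩ := (isCompact_closedBall (0 : E) ((j : ℝ) + 1)).exists_bound_of_continuousOn
      (g k).continuous.continuousOn
    have hC0 : 0 ≤ C := (norm_nonneg _).trans (hC 0 (by simp [(hpos' j).le]))
    refine ⟨C * M, fun n => ?_⟩
    have h1 := abs_integral_sub_le (γs n).finite_away (hGt k j) hzero
      ((isTest_farCutoff (hpos j)).const_mul C) (fun x => by
        rw [sub_zero, abs_mul, abs_of_nonneg (hχ0 j x)]
        rcases le_total ‖x‖ ((j : ℝ) + 1) with hx | hx
        · exact mul_le_mul (hC x (by simpa using hx)) (hχle j x) (hχ0 j x) hC0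
        · rw [hχfar j x hx, mul_zero]
          exact mul_nonneg hC0 (farCutoff_nonneg _ _))
    rw [integral_zero, sub_zero, integral_const_mul] at h1
    exact abs_le.1 (h1.trans (mul_le_mul_of_nonneg_left (hM n) hC0))
  choose B hB using hbdd
  -- The diagonal extraction: a countable product of compact intervals is sequentially compact.
  obtain ⟨a, -, φ, hφ, hlim⟩ :=
    (isCompact_univ_pi fun i : ℕ × ℕ => isCompact_Icc (a := -B i) (b := B i)).tendsto_subseq
      (x := fun n i => ∫ x, g i.1 x * χ i.2 x ∂(γs n).toMeasure) fun n i _ => hB i n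
  rw [tendsto_pi_nhds] at hlim
  refine ⟨φ, hφ, fun F hF => exists_tendsto_of_approx fun ε hεpos => ?_⟩
  obtain ⟨C, hC⟩ := hF.bounded
  have hC0 : 0 ≤ C := (abs_nonneg _).trans (hC 0)
  obtain ⟨δ, hδ, hball⟩ := Metric.eventually_nhds_iff_ball.1 hF.eventually_zero
  -- The error `ε` is split into a tail part, `C` times the mass beyond `R`, and an approximation
  -- part, `η` times the mass bound `M`. The `+ 1` keeps the denominators positive.
  obtain ⟨R, hR, hRε⟩ := hε (ε / (2 * (C + 1))) (by positivity)
  obtain ⟨j₁, hj₁⟩ := exists_nat_ge R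
  obtain ⟨j₂, hj₂⟩ := exists_nat_one_div_lt hδ
  set j := max j₁ j₂ with hj
  have hjR : R ≤ (j : ℝ) + 1 := by
    have : (j₁ : ℝ) ≤ j := by exact_mod_cast le_max_left j₁ j₂
    linarith
  have hjδ : 1 / ((j : ℝ) + 1) ≤ δ := by
    have : (j₂ : ℝ) ≤ j := by exact_mod_cast le_max_right j₁ j₂
    exact (one_div_le_one_div_of_le (by positivity) (by linarith)).trans hj₂.le
  obtain ⟨M, hM⟩ := hM _ (hpos j)
  have hM0 : 0 ≤ M := (integral_nonneg fun x => farCutoff_nonneg _ _).trans (hM 0)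
  set η : ℝ := ε / (2 * (M + 1)) with hη
  have hηpos : 0 < η := by positivity
  obtain ⟨k, hk⟩ : ∃ k, ∀ x ∈ Metric.closedBall (0 : E) ((j : ℝ) + 1), |F x - g k x| ≤ η := by
    have : CompactSpace (Metric.closedBall (0 : E) ((j : ℝ) + 1)) :=
      isCompact_iff_compactSpace.1 (isCompact_closedBall _ _)
    obtain ⟨k, hk⟩ := (TopologicalSpace.denseRange_denseSeq C(E, ℝ)).exists_mem_open
      (Metric.isOpen_ball.preimage (ContinuousMap.continuous_restrict
        (Metric.closedBall (0 : E) ((j : ℝ) + 1))) (X := C(E, ℝ)))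
      ⟨⟨F, hF.continuous⟩, Metric.mem_ball_self hηpos⟩
    refine ⟨k, fun x hx => ?_⟩
    have h1 := (ContinuousMap.dist_apply_le_dist (⟨x, hx⟩ :
      Metric.closedBall (0 : E) ((j : ℝ) + 1))).trans (Metric.mem_ball.1 hk).le
    rw [dist_comm] at h1
    exact h1
  refine ⟨fun n => ∫ x, g k x * χ j x ∂(γs (φ n)).toMeasure, ⟨a (k, j), hlim (k, j)⟩, ?_⟩
  filter_upwards [hφ.tendsto_atTop.eventually hRε] with n hn
  have hH := ((isTest_farCutoff (E := E) hR).const_mul C).add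
    ((isTest_farCutoff (E := E) (hpos j)).const_mul η)
  have hdom : ∀ x, |F x - g k x * χ j x| ≤
      C * farCutoff R x + η * farCutoff (1 / ((j : ℝ) + 1)) x := by
    intro x
    have e : F x - g k x * χ j x = (F x - F x * χ j x) + (F x - g k x) * χ j x := by ring
    rw [e]
    refine (abs_add_le _ _).trans (add_le_add ?_ ?_)
    · rcases lt_or_ge ‖x‖ δ with hx | hx
      · rw [hball x (by simpa using hx), zero_mul, sub_zero, abs_zero]
        exact mul_nonneg hC0 (farCutoff_nonneg _ _)
      · have : F x - F x * χ j x = F x * farCutoff ((j : ℝ) + 1) x := by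
          simp only [hχ]
          rw [farCutoff_eq_one (hpos j) (hjδ.trans hx)]
          ring
        rw [this, abs_mul, abs_of_nonneg (farCutoff_nonneg _ _)]
        exact mul_le_mul (hC x) (farCutoff_anti hR hjR x) (farCutoff_nonneg _ _) hC0
    · rw [abs_mul, abs_of_nonneg (hχ0 j x)]
      rcases le_total ‖x‖ ((j : ℝ) + 1) with hx | hx
      · exact mul_le_mul (hk x (by simpa using hx)) (hχle j x) (hχ0 j x) hηpos.le
      · rw [hχfar j x hx, mul_zero]
        exact mul_nonneg hηpos.le (farCutoff_nonneg _ _)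
  refine (abs_integral_sub_le (γs (φ n)).finite_away hF (hGt k j) hH hdom).trans ?_
  rw [integral_add (((isTest_farCutoff hR).const_mul C).integrable (γs (φ n)).finite_away)
    (((isTest_farCutoff (hpos j)).const_mul η).integrable (γs (φ n)).finite_away),
    integral_const_mul, integral_const_mul]
  have h1 : C * ∫ x : Punctured E, farCutoff R (x : E) ∂(γs (φ n)).toMeasure ≤ ε / 2 := by
    refine (mul_le_mul_of_nonneg_left hn hC0).trans ?_
    rw [mul_div_assoc', div_le_div_iff₀ (by positivity) two_pos]
    nlinarith
  have h2 : η * ∫ x : Punctured E, farCutoff (1 / ((j : ℝ) + 1)) (x : E) ∂(γs (φ n)).toMeasure ≤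
      ε / 2 := by
    refine (mul_le_mul_of_nonneg_left (hM (φ n)) hηpos.le).trans ?_
    rw [hη, div_mul_eq_mul_div, div_le_div_iff₀ (by positivity) two_pos]
    nlinarith
  linarith

/-- If the integrals of all test functions converge and no mass escapes to infinity, then the
sequence converges in `M₀(E)`. -/
theorem exists_tendsto_of_forall_integral_tendsto {γs : ℕ → MZero E}
    (hconv : ∀ F : E → ℝ, IsTest F →
      ∃ L, Tendsto (fun k => ∫ x, F x ∂(γs k).toMeasure) atTop (𝓝 L))
    (hε : ∀ ε : ℝ, 0 < ε → ∃ R : ℝ, 0 < R ∧ ∀ᶠ n in atTop,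
      ∫ x : Punctured E, farCutoff R (x : E) ∂(γs n).toMeasure ≤ ε) :
    ∃ γ : MZero E, Tendsto γs atTop (𝓝 γ) := by
  choose! L hL using hconv
  have hconvc : ∀ f : CompactlySupportedContinuousMap (Punctured E) ℝ,
      ∃ l, Tendsto (fun k => ∫ x, f x ∂(γs k).toMeasure) atTop (𝓝 l) := by
    intro f
    obtain ⟨F, hF, hval⟩ := exists_isTest_of_compactlySupported f
    exact ⟨L F, by simpa only [hval] using hL F hF⟩
  have hint : ∀ (f : CompactlySupportedContinuousMap (Punctured E) ℝ) (k : ℕ),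
      Integrable (fun x => f x) (γs k).toMeasure := by
    intro f k
    obtain ⟨F, hF, hval⟩ := exists_isTest_of_compactlySupported f
    simpa only [hval] using hF.integrable (γs k).finite_away
  choose l hl using hconvc
  let Λ₀ : CompactlySupportedContinuousMap (Punctured E) ℝ →ₗ[ℝ] ℝ :=
    { toFun := l
      map_add' := fun f g => by
        refine tendsto_nhds_unique (hl (f + g)) (((hl f).add (hl g)).congr fun k => ?_)
        rw [← integral_add (hint f k) (hint g k)]
        rfl
      map_smul' := fun c f => by
        refine tendsto_nhds_unique (hl (c • f)) (((hl f).const_mul c).congr fun k => ?_)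
        rw [← integral_const_mul]
        rfl }
  -- The limits of the integrals form a positive functional; its Riesz measure is the candidate
  -- limit.
  let Λ : CompactlySupportedContinuousMap (Punctured E) ℝ →ₚ[ℝ] ℝ :=
    PositiveLinearMap.mk₀ Λ₀ fun f hf =>
      ge_of_tendsto' (hl f) fun k => integral_nonneg fun x => hf x
  set m : Measure (Punctured E) := RealRMK.rieszMeasure Λ
  have hmint : ∀ f : CompactlySupportedContinuousMap (Punctured E) ℝ, ∫ x, f x ∂m = l f :=
    fun f => RealRMK.integral_rieszMeasure Λ f
  have hfin : FiniteAwayFromZero m := by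
    intro A _ hA0
    obtain ⟨δ, hδ, hball⟩ := Metric.nhds_basis_ball.mem_iff.1
      (isClosed_closure.isOpen_compl.mem_nhds hA0)
    set K : ℕ → Set (Punctured E) := fun j => {x | δ ≤ ‖(x : E)‖ ∧ ‖(x : E)‖ ≤ ((j : ℝ) + 1) / 2}
      with hK
    have hKc : ∀ j, IsCompact (K j) := fun j => isCompact_punctured_annulus hδ _
    -- The truncated cutoff equals `1` on `K j`, since `farCutoff (j + 1)` vanishes up to radius `(j
    -- + 1) / 2`; the bound does not depend on `j`.
    have hKle : ∀ j, m (K j) ≤ ENNReal.ofReal (L (farCutoff δ)) := by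
      intro j
      have hj : (0 : ℝ) < (j : ℝ) + 1 := by positivity
      obtain ⟨f, hf⟩ := (isTest_farCutoff (E := E) hδ).exists_truncation hj
      refine (RealRMK.rieszMeasure_le_of_eq_one Λ (f := f) (fun x => ?_) (hKc j)
        fun x hx => ?_).trans (ENNReal.ofReal_le_ofReal ?_)
      · rw [hf]
        exact mul_nonneg (farCutoff_nonneg _ _) (sub_nonneg.2 (farCutoff_le_one _ _))
      · rw [hf, farCutoff_eq_one hδ hx.1, farCutoff_eq_zero hj hx.2, sub_zero, mul_one]
      · refine le_of_tendsto_of_tendsto' (hl f) (hL _ (isTest_farCutoff hδ)) fun k =>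
          integral_mono (hint f k) ((isTest_farCutoff hδ).integrable (γs k).finite_away) fun x => ?_
        simp only [hf]
        exact mul_le_of_le_one_right (farCutoff_nonneg _ _)
          (by linarith [farCutoff_nonneg ((j : ℝ) + 1) (x : E)])
    have hKmono : Monotone K := by
      intro i j hij x hx
      have : (i : ℝ) ≤ j := by exact_mod_cast hij
      exact ⟨hx.1, hx.2.trans (by linarith)⟩
    have hAK : A ⊆ ⋃ j, K j := by
      intro x hx
      obtain ⟨j, hj⟩ := exists_nat_ge (2 * ‖(x : E)‖)
      refine Set.mem_iUnion.2 ⟨j, ?_, by linarith⟩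
      by_contra hlt
      exact hball (mem_ball_zero_iff.2 (not_le.1 hlt)) (subset_closure ⟨x, hx, rfl⟩)
    calc m A ≤ m (⋃ j, K j) := measure_mono hAK
      _ = ⨆ j, m (K j) := hKmono.measure_iUnion
      _ ≤ ENNReal.ofReal (L (farCutoff δ)) := iSup_le hKle
      _ < ⊤ := ENNReal.ofReal_lt_top
  refine ⟨⟨m, hfin⟩, tendsto_mZero_iff_isTest.2 fun F hF => ?_⟩
  suffices h : ∫ x, F x ∂m = L F by
    simp only [h]
    exact hL F hF
  obtain ⟨C, hC⟩ := hF.bounded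
  have hC0 : 0 ≤ C := (abs_nonneg _).trans (hC 0)
  refine eq_of_abs_sub_le_all fun ε hεpos => ?_
  obtain ⟨R, hR, hRε⟩ := hε (ε / (2 * (C + 1))) (by positivity)
  -- The identity is known for compactly supported functions, so `F` is truncated at a radius beyond
  -- which both `m` and, eventually, the measures `γs k` have small mass.
  obtain ⟨j, hjm, hjR⟩ := (((tendsto_integral_farCutoff hfin).eventually
    (gt_mem_nhds (show (0 : ℝ) < ε / (2 * (C + 1)) by positivity))).and
    (tendsto_natCast_atTop_atTop.eventually (eventually_ge_atTop R))).exists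
  set S : ℝ := (j : ℝ) + 1 with hS
  have hSpos : 0 < S := by positivity
  obtain ⟨f, hf⟩ := hF.exists_truncation hSpos
  obtain ⟨F', hF', hval⟩ := exists_isTest_of_compactlySupported f
  have hdom : ∀ x, |F x - F' x| ≤ C * farCutoff S x := by
    intro x
    by_cases h0 : x = 0
    · rw [h0, hF.eventually_zero.self_of_nhds, hF'.eventually_zero.self_of_nhds, sub_self, abs_zero]
      exact mul_nonneg hC0 (farCutoff_nonneg _ _)
    · rw [hval ⟨x, h0⟩, hf]
      have e : F x - F x * (1 - farCutoff S x) = F x * farCutoff S x := by ring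
      rw [e, abs_mul, abs_of_nonneg (farCutoff_nonneg _ _)]
      exact mul_le_mul_of_nonneg_right (hC x) (farCutoff_nonneg _ _)
  have hHt := (isTest_farCutoff (E := E) hSpos).const_mul C
  have hCε : C * (ε / (2 * (C + 1))) ≤ ε / 2 := by
    rw [mul_div_assoc', div_le_div_iff₀ (by positivity) two_pos]
    nlinarith
  have h1 : |∫ x : Punctured E, F x ∂m - l f| ≤ ε / 2 := by
    have := abs_integral_sub_le hfin hF hF' hHt hdom
    rw [integral_const_mul] at this
    simp only [hval] at this
    rw [hmint] at this
    exact this.trans ((mul_le_mul_of_nonneg_left hjm.le hC0).trans hCε)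
  have h2 : |L F - l f| ≤ ε / 2 := by
    refine le_of_tendsto ((hL F hF).sub (hl f)).abs ?_
    filter_upwards [hRε] with k hk
    have := abs_integral_sub_le (γs k).finite_away hF hF' hHt hdom
    rw [integral_const_mul] at this
    simp only [hval] at this
    refine this.trans ((mul_le_mul_of_nonneg_left (le_trans ?_ hk) hC0).trans hCε)
    exact integral_mono ((isTest_farCutoff hSpos).integrable (γs k).finite_away)
      ((isTest_farCutoff hR).integrable (γs k).finite_away)
      fun x => farCutoff_anti hR (by linarith) _
  rw [abs_le] at h1 h2 ⊢
  constructor <;> linarith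

/-- Zero-couplings of convergent sequences have a convergent subsequence. -/
theorem exists_subseq_tendsto_of_zeroCouplings {μ ν : MZero E} {μs νs : ℕ → MZero E}
    {γs : ℕ → MZero (E × E)} (hμ : Tendsto μs atTop (𝓝 μ)) (hν : Tendsto νs atTop (𝓝 ν))
    (hγ : ∀ n, γs n ∈ zeroCouplings (μs n) (νs n)) :
    ∃ φ : ℕ → ℕ, StrictMono φ ∧ ∃ γ, Tendsto (fun k => γs (φ k)) atTop (𝓝 γ) := by
  rw [tendsto_mZero_iff_isTest] at hμ hν
  have hle : ∀ R : ℝ, 0 < R → ∀ n,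
      ∫ z : Punctured (E × E), farCutoff R (z : E × E) ∂(γs n).toMeasure ≤
        ∫ x : Punctured E, farCutoff R (x : E) ∂(μs n).toMeasure +
          ∫ x : Punctured E, farCutoff R (x : E) ∂(νs n).toMeasure := by
    intro R hR n
    have ht := isTest_farCutoff (E := E) hR
    have hfa := (γs n).finite_away
    rw [← (hγ n).1, ← (hγ n).2,
      integral_leftMarginal _ ht.continuous ht.eventually_zero.self_of_nhds,
      integral_rightMarginal _ ht.continuous ht.eventually_zero.self_of_nhds,
      ← integral_add (ht.comp_fst.integrable hfa) (ht.comp_snd.integrable hfa)]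
    exact integral_mono ((isTest_farCutoff hR).integrable hfa)
      ((ht.comp_fst.add ht.comp_snd).integrable hfa) fun z => farCutoff_prod_le R _
  -- Tightness: the limits `μ`, `ν` have small tails, and the tail cutoff is itself a test function,
  -- so the tails of `μs n`, `νs n` are eventually small.
  have hε : ∀ ε : ℝ, 0 < ε → ∃ R : ℝ, 0 < R ∧ ∀ᶠ n in atTop,
      ∫ z : Punctured (E × E), farCutoff R (z : E × E) ∂(γs n).toMeasure ≤ ε := by
    intro ε hε
    obtain ⟨j, h1, h2⟩ := (((tendsto_integral_farCutoff μ.finite_away).eventually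
      (gt_mem_nhds (half_pos hε))).and ((tendsto_integral_farCutoff ν.finite_away).eventually
      (gt_mem_nhds (half_pos hε)))).exists
    have hj : (0 : ℝ) < (j : ℝ) + 1 := by positivity
    refine ⟨(j : ℝ) + 1, hj, ?_⟩
    filter_upwards [(hμ _ (isTest_farCutoff hj)).eventually (gt_mem_nhds h1),
      (hν _ (isTest_farCutoff hj)).eventually (gt_mem_nhds h2)] with n h3 h4
    linarith [hle _ hj n]
  obtain ⟨φ, hφ, hconv⟩ := exists_subseq_forall_integral_tendsto (γs := γs) (fun R hR => by
    obtain ⟨A, hA⟩ := (hμ _ (isTest_farCutoff hR)).bddAbove_range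
    obtain ⟨B, hB⟩ := (hν _ (isTest_farCutoff hR)).bddAbove_range
    exact ⟨A + B, fun n => (hle R hR n).trans
      (add_le_add (hA (Set.mem_range_self n)) (hB (Set.mem_range_self n)))⟩) hε
  exact ⟨φ, hφ, exists_tendsto_of_forall_integral_tendsto hconv fun ε hpos =>
    (hε ε hpos).imp fun R h => ⟨h.1, hφ.tendsto_atTop.eventually h.2⟩⟩

end Compactness

/-- Sequences of closed subsets of a second countable space have Fell convergent subsequences. -/
theorem exists_subseq_tendsto_fell {X : Type*} [TopologicalSpace X] [SecondCountableTopology X]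
    (Ts : ℕ → FellSpace X) :
    ∃ φ : ℕ → ℕ, StrictMono φ ∧ ∃ T, Tendsto (fun k => Ts (φ k)) atTop (𝓝 T) := by
  classical
  have : Countable (TopologicalSpace.countableBasis X) :=
    (TopologicalSpace.countable_countableBasis X).to_subtype
  -- Each closed set is coded by which basic open sets it hits, a point of a countable power of
  -- `Bool`. The limit set consists of the points all of whose basic neighbourhoods are hit in the
  -- limit code.
  obtain ⟨a, φ, hφ, hlim⟩ := CompactSpace.tendsto_subseq
    fun n (b : TopologicalSpace.countableBasis X) =>
      decide ((Ts n : Set X) ∩ (b : Set X)).Nonempty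
  have hev : ∀ b : TopologicalSpace.countableBasis X, ∀ᶠ k in atTop,
      decide ((Ts (φ k) : Set X) ∩ (b : Set X)).Nonempty = a b := by
    intro b
    have := tendsto_pi_nhds.1 hlim b
    rwa [nhds_discrete, tendsto_pure] at this
  set T : Set X := {x | ∀ b : TopologicalSpace.countableBasis X, x ∈ (b : Set X) → a b = true}
    with hT
  have hTc : IsClosed T := by
    have : T = ⋂ (b : TopologicalSpace.countableBasis X) (_ : a b ≠ true), (b : Set X)ᶜ := by
      ext x
      simp only [hT, Set.mem_ofPred_eq, Set.mem_iInter, Set.mem_compl_iff]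
      exact forall_congr' fun b => not_imp_not.symm
    rw [this]
    exact isClosed_iInter fun b => isClosed_iInter fun _ =>
      (TopologicalSpace.isOpen_of_mem_countableBasis b.2).isClosed_compl
  refine ⟨φ, hφ, (⟨T, hTc⟩ : TopologicalSpace.Closeds X), tendsto_fell_iff.2 ⟨?_, ?_⟩⟩
  · rintro G hG ⟨x, hxT, hxG⟩
    obtain ⟨b, hb, hxb, hbG⟩ :=
      (TopologicalSpace.isBasis_countableBasis X).exists_subset_of_mem_open hxG hG
    filter_upwards [hev ⟨b, hb⟩] with k hk
    rw [hxT ⟨b, hb⟩ hxb, decide_eq_true_eq] at hk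
    exact hk.mono (Set.inter_subset_inter_right _ hbG)
  · intro K hK hTK
    -- Being eventually missed is local and stable under finite unions, so compactness carries it to
    -- `K`.
    have hcov : ∀ x ∈ K, ∃ s ∈ 𝓝[K] x, ∀ᶠ k in atTop, (Ts (φ k) : Set X) ∩ s = ∅ := by
      intro x hx
      have hxT : x ∉ T := fun h => Set.notMem_empty x (hTK ▸ ⟨h, hx⟩)
      simp only [hT, Set.mem_ofPred_eq, not_forall] at hxT
      obtain ⟨b, hxb, hab⟩ := hxT
      refine ⟨b, mem_nhdsWithin_of_mem_nhds
        ((TopologicalSpace.isOpen_of_mem_countableBasis b.2).mem_nhds hxb), ?_⟩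
      filter_upwards [hev b] with k hk
      rw [← Set.not_nonempty_iff_eq_empty]
      intro hne
      exact hab (hk ▸ decide_eq_true hne)
    refine hK.induction_on (p := fun s => ∀ᶠ k in atTop, (Ts (φ k) : Set X) ∩ s = ∅)
      (by simp) ?_ ?_ hcov
    · intro s t hst ht
      filter_upwards [ht] with k hk
      exact Set.subset_empty_iff.1 (hk ▸ Set.inter_subset_inter_right _ hst)
    · intro s t hs ht
      filter_upwards [hs, ht] with k hk1 hk2
      rw [Set.inter_union_distrib_left, hk1, hk2, Set.union_empty]

end ZeroCoupling

/-! ### Assembly and nonemptiness of Fell limit points. -/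

namespace ZeroCoupling

variable {E : Type*} [NormedAddCommGroup E] [MeasurableSpace E]

/-- Only the zero measure has empty support. -/
theorem MZero.toMeasure_eq_zero_of_support [SecondCountableTopology E] {γ : MZero E}
    (h : γ.support = ∅) : γ.toMeasure = 0 :=
  (Measure.map_eq_zero_iff measurable_subtype_coe.aemeasurable).1
    (Measure.support_eq_empty_iff.1 h)

variable [BorelSpace E]

/-- Zero-couplings of convergent sequences and closed sets that contain their supports have
convergent subsequences, with the inclusion of the support preserved in the limit. -/
theorem exists_subseq_tendsto_of_zeroCouplings_of_support_subset [ProperSpace E] {μ ν : MZero E}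
    {μs νs : ℕ → MZero E} {γs : ℕ → MZero (E × E)} {Ts : ℕ → FellSpace (E × E)}
    (hμ : Tendsto μs atTop (𝓝 μ)) (hν : Tendsto νs atTop (𝓝 ν))
    (hγ : ∀ n, γs n ∈ zeroCouplings (μs n) (νs n)) (hT : ∀ n, (γs n).support ⊆ Ts n) :
    ∃ φ : ℕ → ℕ, StrictMono φ ∧ ∃ γ ∈ zeroCouplings μ ν, ∃ T : FellSpace (E × E),
      Tendsto (fun k => γs (φ k)) atTop (𝓝 γ) ∧ Tendsto (fun k => Ts (φ k)) atTop (𝓝 T) ∧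
        γ.support ⊆ T := by
  obtain ⟨φ, hφ, γ, hlim⟩ := exists_subseq_tendsto_of_zeroCouplings hμ hν hγ
  obtain ⟨ψ, hψ, T, hTlim⟩ := exists_subseq_tendsto_fell fun k => Ts (φ k)
  have hlim' := hlim.comp hψ.tendsto_atTop
  have hφψ := (hφ.comp hψ).tendsto_atTop
  exact ⟨φ ∘ ψ, hφ.comp hψ, γ, mem_zeroCouplings_of_tendsto hlim' (hμ.comp hφψ) (hν.comp hφψ)
    fun k => hγ _, T, hlim', hTlim, support_subset_of_tendsto hlim' hTlim fun k => hT _⟩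

/-- If the limit marginals do not both vanish, then the Fell limit points are nonempty. -/
theorem nonempty_of_mapClusterPt [ProperSpace E] {μ ν : MZero E}
    {μs νs : ℕ → MZero E} {γs : ℕ → MZero (E × E)} {Ts : ℕ → FellSpace (E × E)}
    (hμ : Tendsto μs atTop (𝓝 μ)) (hν : Tendsto νs atTop (𝓝 ν))
    (hγ : ∀ n, γs n ∈ zeroCouplings (μs n) (νs n)) (hT : ∀ n, (γs n).support ⊆ Ts n)
    (hne : μ.toMeasure ≠ 0 ∨ ν.toMeasure ≠ 0) {T : FellSpace (E × E)}
    (hTc : MapClusterPt T atTop Ts) : (T : Set (E × E)).Nonempty := by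
  by_contra hempty
  rw [Set.not_nonempty_iff_eq_empty] at hempty
  obtain ⟨U, hU, hTU⟩ := mapClusterPt_iff_ultrafilter.1 hTc
  have hfreq : ∀ k : ℕ, ∃ᶠ n in atTop,
      (Ts n : Set (E × E)) ∩ Metric.closedBall 0 (k : ℝ) = ∅ := fun k =>
    (((tendsto_fell_iff.1 hTU).2 _ (isCompact_closedBall 0 (k : ℝ))
      (by rw [hempty, Set.empty_inter])).frequently).filter_mono hU
  -- An empty limit point yields a genuine subsequence whose `k`-th set misses the ball of radius
  -- `k`, to which sequential compactness applies: its Fell limits are empty, so the limit coupling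
  -- and both marginals vanish.
  obtain ⟨ψ, hψ, hψT⟩ := extraction_forall_of_frequently hfreq
  obtain ⟨φ, hφ, γ, hγc, T', -, hT', hsub⟩ :=
    exists_subseq_tendsto_of_zeroCouplings_of_support_subset (hμ.comp hψ.tendsto_atTop)
      (hν.comp hψ.tendsto_atTop) (fun k => hγ (ψ k)) (fun k => hT (ψ k))
  have hT'e : (T' : Set (E × E)) = ∅ := by
    refine Set.eq_empty_of_forall_notMem fun z hz => ?_
    obtain ⟨j, hj⟩ := exists_nat_gt ‖z‖
    obtain ⟨k, ⟨w, hw, hwj⟩, hk⟩ := (((tendsto_fell_iff.1 hT').1 (Metric.ball 0 (j : ℝ))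
      Metric.isOpen_ball ⟨z, hz, mem_ball_zero_iff.2 hj⟩).and
      (hφ.tendsto_atTop.eventually (eventually_ge_atTop j))).exists
    have hjk : (j : ℝ) ≤ φ k := by exact_mod_cast hk
    exact Set.notMem_empty w (hψT (φ k) ▸
      ⟨hw, Metric.closedBall_subset_closedBall hjk (Metric.ball_subset_closedBall hwj)⟩)
  have h0 := MZero.toMeasure_eq_zero_of_support (Set.subset_empty_iff.1 (hT'e ▸ hsub))
  obtain ⟨h1, h2⟩ := hγc
  rw [h0] at h1 h2
  rcases hne with h | h
  · exact h (by rw [← h1, leftMarginal, Measure.map_zero, Measure.comap_zero])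
  · exact h (by rw [← h2, rightMarginal, Measure.map_zero, Measure.comap_zero])

end ZeroCoupling

theorem mainTheorem6 (d : ℕ)
    (μ ν : MZero (EuclideanSpace ℝ (Fin d)))
    (μs νs : ℕ → MZero (EuclideanSpace ℝ (Fin d)))
    (γs : ℕ → MZero (EuclideanSpace ℝ (Fin d) × EuclideanSpace ℝ (Fin d)))
    (Ts : ℕ → FellSpace (EuclideanSpace ℝ (Fin d) × EuclideanSpace ℝ (Fin d)))
    (hμ : Tendsto μs atTop (𝓝 μ)) (hν : Tendsto νs atTop (𝓝 ν))
    (hγ : ∀ n, γs n ∈ zeroCouplings (μs n) (νs n))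
    (hT : ∀ n, (γs n).support ⊆ Ts n) :
    (∃ φ : ℕ → ℕ, StrictMono φ ∧ ∃ γ ∈ zeroCouplings μ ν,
      ∃ T : FellSpace (EuclideanSpace ℝ (Fin d) × EuclideanSpace ℝ (Fin d)),
        Tendsto (fun k => γs (φ k)) atTop (𝓝 γ) ∧
        Tendsto (fun k => Ts (φ k)) atTop (𝓝 T) ∧
        γ.support ⊆ T) ∧
    ((∀ n, γs n ∈ cmZeroCouplings (μs n) (νs n)) →
      (∀ n, IsMaximalCyclicallyMonotone (Ts n : Set (EuclideanSpace ℝ (Fin d) ×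
        EuclideanSpace ℝ (Fin d)))) →
      (∀ γ, MapClusterPt γ atTop γs → γ ∈ cmZeroCouplings μ ν) ∧
      (μ.toMeasure ≠ 0 ∨ ν.toMeasure ≠ 0 →
        ∀ T, MapClusterPt T atTop Ts →
          IsMaximalCyclicallyMonotone (T : Set (EuclideanSpace ℝ (Fin d) ×
            EuclideanSpace ℝ (Fin d))))) := by
  refine ⟨exists_subseq_tendsto_of_zeroCouplings_of_support_subset hμ hν hγ hT,
    fun hcm hmax => ⟨fun γ hγc => ?_, fun hne T hTc => ?_⟩⟩
  -- A limit point is a limit along an ultrafilter finer than `atTop`, so no countability of the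
  -- topology is needed to apply the limit lemmas.
  · obtain ⟨U, hU, hlim⟩ := mapClusterPt_iff_ultrafilter.1 hγc
    exact ⟨mem_zeroCouplings_of_tendsto hlim (hμ.mono_left hU) (hν.mono_left hU) hγ,
      isCyclicallyMonotone_of_lowerLimit (fun n => (hcm n).2)
        (eventually_support_inter_nonempty hlim)⟩
  · obtain ⟨U, -, hlim⟩ := mapClusterPt_iff_ultrafilter.1 hTc
    exact isMaximalCyclicallyMonotone_of_tendsto hlim hmax
      (nonempty_of_mapClusterPt hμ hν hγ hT hne hTc)
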